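/- **Theorem 4.3.** Let $\mathcal M=\mathrm{St}(n,r)=\{X\in\mathbb R^{n\times r}: X^\top X=I_r\}$, with tangent spaces $T_X\mathcal M=\{V: V^\top X+X^\top V=0\}$ and the inner product $\langle A,B\rangle=\mathrm{tr}(A^\top B)$ with norm $\|\cdot\|$. Let $f:\mathbb R^{n\times r}\to\mathbb R$ be twice continuously differentiable with $\nabla f$ Lipschitz continuous, let $h:\mathbb R^{n\times r}\to\mathbb R$ be convex and Lipschitz continuous with constant $L_h$, and put $F=f+h$. Let $\mathbf R$ be a retraction on $\mathcal M$, that is, a smooth map $T\mathcal M\to\mathcal M$ with $\mathbf R_X(0)=X$ and $D\mathbf R_X(0)=\mathrm{id}_{T_X\mathcal M}$ for all $X\in\mathcal M$, and let $M_2>0$ be a constant with $\|\mathbf R_X(\xi)-X-\xi\|\le M_2\|\xi\|^2$ for all $X\in\mathcal M$, $\xi\in T_X\mathcal M$. Let $m\ge 1$ be an integer, $\sigma,\gamma\in(0,1)$, and let $\{X_k\}_{k\ge0}$ be generated by the proximal quasi-Newton method with nonmonotone line search: $X_0\in\mathcal M$, and for each $k\ge 0$, with a linear operator $\mathcal B_k$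 on $\mathbb R^{n\times r}$ mapping $T_{X_k}\mathcal M$ into itself and $\|V\|_{\mathcal B_k}^2:=\langle V,\mathcal B_k[V]\rangle$, $$V_k=\arg\min_{V\in T_{X_k}\mathcal M}\Big\{\langle\nabla f(X_k),V\rangle+\tfrac12\|V\|_{\mathcal B_k}^2+h(X_k+V)\Big\},\qquad X_{k+1}=\mathbf R_{X_k}(\alpha_kV_k),$$ where $\alpha_k=\gamma^{N_k}$ and $N_k\ge 0$ is the smallest integer such that $$F(\mathbf R_{X_k}(\alpha_kV_k))\le\max_{\max\{0,k-m\}\le j\le k}F(X_j)-\tfrac12\sigma\alpha_k\|V_k\|_{\mathcal B_k}^2 .$$ Let $l(k)\in\arg\max_{\max\{0,k-m\}\le j\le k}F(X_j)$. Suppose that there are constants $\kappa_1>0$ and $\kappa_2$ such that for all $k$ $$\kappa_1\|V\|^2\le\|V\|_{\mathcal B_k}^2\le\kappa_2\|V\|^2\qquad\text{for all }V\in T_{X_k}\mathcal M ,$$ and that $\{X_k\}$ has an accumulation point $X^*$ with $$\lambda_{\min}\big(\mathrm{Hess}(f\circ\mathbf R_{X^*})(0_{X^*})\big)\ge\widetilde\eta\quad\text{for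 some }\widetilde\eta>5L_hM_2 .$$ Then there exist an integer $K\ge0$, $\mu>0$ and $\tau\in(0,1)$ such that $$F(X_k)-F(X^*)\le\mu\,\tau^{k-K}\big(F(X_{l(K)})-F(X^*)\big)\qquad\text{for all }k>K .$$ -/

import Mathlib

open scoped Matrix Topology ContDiff NNReal

namespace ManPQN

/-- The space of real `n × r` matrices with the Frobenius norm and inner product, realized as the
Euclidean space with one coordinate for each entry. -/
abbrev Mat (n r : ℕ) : Type := EuclideanSpace ℝ (Fin n × Fin r)

/-- The underlying matrix. -/
def toMatrix {n r : ℕ} : Mat n r →ₗ[ℝ] Matrix (Fin n) (Fin r) ℝ where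
  toFun X := Matrix.of fun i j => X (i, j)
  map_add' _ _ := rfl
  map_smul' _ _ := rfl

theorem toMatrix_apply {n r : ℕ} (X : Mat n r) (i : Fin n) (j : Fin r) :
    toMatrix X i j = X (i, j) := rfl

/-- The inner product is the Frobenius inner product `⟪A, B⟫ = tr (Aᵀ B)`. -/
theorem inner_eq_trace {n r : ℕ} (A B : Mat n r) :
    inner ℝ A B = ((toMatrix A)ᵀ * toMatrix B).trace := by
  simp only [PiLp.inner_apply, Fintype.sum_prod_type, Matrix.trace, Matrix.diag, Matrix.mul_apply]
  rw [Finset.sum_comm]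
  simp [toMatrix_apply, mul_comm]

/-- The Stiefel manifold `St(n, r) = {X : Xᵀ X = I}`. -/
def stiefel (n r : ℕ) : Set (Mat n r) := {X | (toMatrix X)ᵀ * toMatrix X = 1}

/-- The tangent space `T_X St(n, r) = {V : Vᵀ X + Xᵀ V = 0}`, as a subspace of the space of
matrices; it inherits the Frobenius inner product, which is the Riemannian metric. -/
def tangent {n r : ℕ} (X : Mat n r) : Submodule ℝ (Mat n r) where
  carrier := {V | (toMatrix V)ᵀ * toMatrix X + (toMatrix X)ᵀ * toMatrix V = 0}
  zero_mem' := by simp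
  add_mem' {V W} hV hW := by
    simp only [Set.mem_ofPred_eq] at hV hW ⊢
    have h := congrArg₂ (· + ·) hV hW
    simp only [add_zero] at h
    rw [← h, map_add, Matrix.transpose_add, Matrix.add_mul, Matrix.mul_add]
    abel
  smul_mem' c V hV := by
    simp only [Set.mem_ofPred_eq] at hV ⊢
    rw [map_smul, Matrix.transpose_smul, Matrix.smul_mul, Matrix.mul_smul, ← smul_add, hV,
      smul_zero]

/-- The tangent bundle of the Stiefel manifold, as a subset of the product of two copies of the
space of matrices. -/
def tangentBundle (n r : ℕ) : Set (Mat n r × Mat n r) :=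
  {p | p.1 ∈ stiefel n r ∧ p.2 ∈ tangent p.1}

/-- `R` is a retraction on the Stiefel manifold: a smooth map from the tangent bundle to the
manifold with `R_X(0) = X` and `D R_X(0) = id` on `T_X St(n, r)`. Only the values `R X ξ` with
`X ∈ St(n, r)` and `ξ ∈ T_X St(n, r)` matter. The tangent bundle is an embedded submanifold, so
smoothness on it is `ContDiffOn`. -/
structure IsRetraction {n r : ℕ} (R : Mat n r → Mat n r → Mat n r) : Prop where
  mapsTo : ∀ X ∈ stiefel n r, ∀ ξ ∈ tangent X, R X ξ ∈ stiefel n r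
  smooth : ContDiffOn ℝ ∞ (fun p : Mat n r × Mat n r => R p.1 p.2) (tangentBundle n r)
  zero : ∀ X ∈ stiefel n r, R X 0 = X
  deriv_zero : ∀ X ∈ stiefel n r,
    HasFDerivAt (fun ξ : tangent X => R X ξ) (tangent X).subtypeL 0

/-- The Hessian at `x` of a function on a finite-dimensional inner product space, as a linear
operator: the derivative of the gradient. -/
noncomputable def hessian {E : Type*} [NormedAddCommGroup E] [InnerProductSpace ℝ E]
    [CompleteSpace E] (g : E → ℝ) (x : E) : E →L[ℝ] E :=
  fderiv ℝ (gradient g) x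

/-- The smallest eigenvalue of the operator `A` is at least `c`. -/
def MinEigenvalueGE {E : Type*} [NormedAddCommGroup E] [InnerProductSpace ℝ E]
    (A : E →L[ℝ] E) (c : ℝ) : Prop :=
  ∀ lam : ℝ, Module.End.HasEigenvalue (A : E →ₗ[ℝ] E) lam → c ≤ lam

/-- The squared norm `‖V‖²_B = ⟪V, B V⟫`. -/
noncomputable def sqNorm {n r : ℕ} (B : Mat n r →ₗ[ℝ] Mat n r) (V : Mat n r) : ℝ :=
  inner ℝ V (B V)

/-- The objective function
`φ(V) = ⟪∇f(X), V⟫ + ‖V‖²_B / 2 + h(X + V)` of the subproblem at `X`. -/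
noncomputable def subproblem {n r : ℕ} (f h : Mat n r → ℝ) (X : Mat n r)
    (B : Mat n r →ₗ[ℝ] Mat n r) (V : Mat n r) : ℝ :=
  inner ℝ (gradient f X) V + sqNorm B V / 2 + h (X + V)

/-- The maximum of `a j` over `max {0, k - m} ≤ j ≤ k` (the subtraction of natural numbers
truncates at `0`). -/
noncomputable def windowMax (m : ℕ) (a : ℕ → ℝ) (k : ℕ) : ℝ :=
  (Finset.Icc (k - m) k).sup' (Finset.nonempty_Icc.2 (Nat.sub_le k m)) a

/-- `l` selects a maximizer of `a j` over each window `max {0, k - m} ≤ j ≤ k`. -/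
def IsWindowArgmax (m : ℕ) (a : ℕ → ℝ) (l : ℕ → ℕ) : Prop :=
  ∀ k, l k ∈ Finset.Icc (k - m) k ∧ ∀ j ∈ Finset.Icc (k - m) k, a j ≤ a (l k)

/-- A run of the proximal quasi-Newton method with nonmonotone line search for minimizing
`F = f + h` over the Stiefel manifold, with iterates `X k`, operators `B k`, search directions
`V k` and stepsizes `γ ^ N k`. -/
structure IsManPQNRun {n r : ℕ} (f h : Mat n r → ℝ) (R : Mat n r → Mat n r → Mat n r)
    (m : ℕ) (σ γ : ℝ) (X : ℕ → Mat n r) (B : ℕ → Mat n r →ₗ[ℝ] Mat n r)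
    (V : ℕ → Mat n r) (N : ℕ → ℕ) : Prop where
  /-- The initial point is on the manifold. -/
  init : X 0 ∈ stiefel n r
  /-- `B k` acts on the tangent space at `X k`. -/
  B_mapsTo : ∀ k, ∀ W ∈ tangent (X k), B k W ∈ tangent (X k)
  /-- The search direction solves the subproblem on the tangent space. -/
  direction_mem : ∀ k, V k ∈ tangent (X k)
  direction_min : ∀ k, ∀ W ∈ tangent (X k),
    subproblem f h (X k) (B k) (V k) ≤ subproblem f h (X k) (B k) W
  /-- Backtracking: `N k` is the first exponent for which the nonmonotone condition holds. -/
  lineSearch : ∀ k, IsLeast {N : ℕ |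
    f (R (X k) (γ ^ N • V k)) + h (R (X k) (γ ^ N • V k)) ≤
      windowMax m (fun j => f (X j) + h (X j)) k - σ * γ ^ N * sqNorm (B k) (V k) / 2} (N k)
  /-- The update. -/
  step : ∀ k, X (k + 1) = R (X k) (γ ^ N k • V k)

end ManPQN

/-! Two points `X` and `Y = X + D` of the Stiefel manifold differ by a tangent vector up to a
quadratic normal correction: `W = D + N(D)`, with `N(D) = X Dᵀ D / 2`, is tangent at `X`. Taylor
expansion of `f` and the Lipschitz bound on `h` show that, up to `o(‖D‖²)`, `F(Y)` exceeds the
linearization `f(X) + ⟪∇f(X), W⟫ + h(X + W)` by at least the quadratic form `chordForm`. At a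
stationary `X*` the tangential gradient has norm at most `Lh`. Passing from the Hessian of `f ∘ R`
to this form therefore costs at most `Lh M₂` for the tangential acceleration of `R`, and the normal
correction in `h` costs another `Lh M₂`, since `‖N(ξ)‖ ≤ M₂ ‖ξ‖²`. On unit tangent vectors the form
is at least `η / 2 - 2 Lh M₂`, so `η > 4 Lh M₂` suffices. Compactness extends the bound to all short
chords near `X*` (`exists_eventually_growth`).

The resulting growth is used in both directions. Based at `X*`, it gives `F(X_k) ≥ F(X*) + c ‖X_k -
X*‖²`; since the values converge and the steps vanish (`IsWindowArgmax.tendsto_of_decrease`), the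
iterates are eventually trapped near `X*`. Based at `X_k` with end point `X*`, it supplies a tangent
competitor in the subproblem, so the predicted decrease is at least a fixed fraction of `F(X_k) -
F(X*)`. With stepsizes bounded below, each new value contracts relative to the window maximum
(`IsManPQNRun.contraction`), which yields an R-linear rate. -/

namespace ManPQN

/-! ### Tangent and normal parts of chords of the Stiefel manifold -/

/-- The product of an element of `Mat n r` with an `r × r` matrix. -/
def mulRight {n r : ℕ} (X : Mat n r) (S : Matrix (Fin r) (Fin r) ℝ) : Mat n r :=
  WithLp.toLp 2 fun p => (toMatrix X * S) p.1 p.2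

theorem toMatrix_mulRight {n r : ℕ} (X : Mat n r) (S : Matrix (Fin r) (Fin r) ℝ) :
    toMatrix (mulRight X S) = toMatrix X * S := rfl

theorem toMatrix_injective {n r : ℕ} : Function.Injective (toMatrix (n := n) (r := r)) := by
  intro X Y h
  ext p
  exact congrFun (congrFun h p.1) p.2

theorem continuous_toMatrix {n r : ℕ} : Continuous (toMatrix (n := n) (r := r)) :=
  toMatrix.continuous_of_finiteDimensional

theorem continuous_mulRight {n r : ℕ} :
    Continuous fun p : Mat n r × Matrix (Fin r) (Fin r) ℝ => mulRight p.1 p.2 := by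
  refine (PiLp.continuous_toLp 2 _).comp (continuous_pi fun p => ?_)
  have : Continuous fun q : Mat n r × Matrix (Fin r) (Fin r) ℝ => toMatrix q.1 * q.2 :=
    (continuous_toMatrix.comp continuous_fst).matrix_mul continuous_snd
  exact this.matrix_elem p.1 p.2

/-- Normal vectors `X S`, with `S` symmetric, are orthogonal to the tangent space. -/
theorem inner_mulRight_of_mem_tangent {n r : ℕ} {X W : Mat n r}
    {S : Matrix (Fin r) (Fin r) ℝ} (hW : W ∈ tangent X) (hS : Sᵀ = S) :
    inner ℝ (mulRight X S) W = 0 := by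
  have hW' : (toMatrix W)ᵀ * toMatrix X + (toMatrix X)ᵀ * toMatrix W = 0 := hW
  rw [inner_eq_trace, toMatrix_mulRight, Matrix.transpose_mul, hS, Matrix.mul_assoc]
  have h1 : (S * ((toMatrix X)ᵀ * toMatrix W)).trace =
      (S * ((toMatrix W)ᵀ * toMatrix X)).trace := by
    rw [← Matrix.trace_transpose, Matrix.transpose_mul, hS, Matrix.trace_mul_comm,
      Matrix.transpose_mul, Matrix.transpose_transpose]
  have h2 : (S * ((toMatrix W)ᵀ * toMatrix X)).trace +
      (S * ((toMatrix X)ᵀ * toMatrix W)).trace = 0 := by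
    rw [← Matrix.trace_add, ← Matrix.mul_add, hW', Matrix.mul_zero, Matrix.trace_zero]
  linarith

/-- The normal vector `X Dᵀ D / 2`. For two points `X`, `X + D` of the Stiefel manifold, it is the
defect of `D` from being tangent at `X`. -/
noncomputable def normalPart {n r : ℕ} (X D : Mat n r) : Mat n r :=
  mulRight X ((1 / 2 : ℝ) • ((toMatrix D)ᵀ * toMatrix D))

theorem continuous_normalPart {n r : ℕ} :
    Continuous fun p : Mat n r × Mat n r => normalPart p.1 p.2 := by
  have h : Continuous fun p : Mat n r × Mat n r =>
      (1 / 2 : ℝ) • ((toMatrix p.2)ᵀ * toMatrix p.2) :=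
    ((continuous_toMatrix.comp continuous_snd).matrix_transpose.matrix_mul
      (continuous_toMatrix.comp continuous_snd)).const_smul (1 / 2 : ℝ)
  exact continuous_mulRight.comp (continuous_fst.prodMk h)

theorem normalPart_smul {n r : ℕ} (X D : Mat n r) (t : ℝ) :
    normalPart X (t • D) = t ^ 2 • normalPart X D := by
  apply toMatrix_injective
  simp only [normalPart, toMatrix_mulRight, map_smul, Matrix.transpose_smul, Matrix.smul_mul,
    Matrix.mul_smul, smul_smul]
  congr 1
  ring

theorem inner_normalPart_of_mem_tangent {n r : ℕ} {X D W : Mat n r} (hW : W ∈ tangent X) :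
    inner ℝ (normalPart X D) W = 0 := by
  refine inner_mulRight_of_mem_tangent hW ?_
  rw [Matrix.transpose_smul, Matrix.transpose_mul, Matrix.transpose_transpose]

/-- With `D = Y - X`, orthonormality of `X` and `Y` gives `Dᵀ X + Xᵀ D = -Dᵀ D`. Since `Xᵀ X = 1`,
the vector `X Dᵀ D / 2` contributes exactly `Dᵀ D` to the same expression. -/
theorem sub_add_normalPart_mem_tangent {n r : ℕ} {X Y : Mat n r} (hX : X ∈ stiefel n r)
    (hY : Y ∈ stiefel n r) : Y - X + normalPart X (Y - X) ∈ tangent X := by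
  have hX' : (toMatrix X)ᵀ * toMatrix X = 1 := hX
  have hY' : (toMatrix Y)ᵀ * toMatrix Y = 1 := hY
  change (toMatrix (Y - X + normalPart X (Y - X)))ᵀ * toMatrix X +
    (toMatrix X)ᵀ * toMatrix (Y - X + normalPart X (Y - X)) = 0
  rw [map_add, normalPart, toMatrix_mulRight, Matrix.transpose_add, Matrix.add_mul, Matrix.mul_add,
    Matrix.transpose_mul, Matrix.mul_assoc _ _ (toMatrix X), hX', ← Matrix.mul_assoc _ (toMatrix X),
    hX', Matrix.mul_one, Matrix.one_mul, Matrix.transpose_smul, Matrix.transpose_mul,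
    Matrix.transpose_transpose, map_sub, Matrix.transpose_sub, Matrix.mul_sub, Matrix.sub_mul,
    Matrix.sub_mul, Matrix.mul_sub, hX', hY']
  module

/-- For a chord `D = Y - X` of the Stiefel manifold, `Dᵀ X + Yᵀ D = 0`. -/
theorem chord_eq {n r : ℕ} {X Y : Mat n r} (hX : X ∈ stiefel n r) (hY : Y ∈ stiefel n r) :
    (toMatrix (Y - X))ᵀ * toMatrix X + (toMatrix Y)ᵀ * toMatrix (Y - X) = 0 := by
  have hX' : (toMatrix X)ᵀ * toMatrix X = 1 := hX
  have hY' : (toMatrix Y)ᵀ * toMatrix Y = 1 := hY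
  rw [map_sub, Matrix.transpose_sub, Matrix.sub_mul, Matrix.mul_sub, hX', hY']
  abel

theorem norm_sq_of_mem_stiefel {n r : ℕ} {X : Mat n r} (hX : X ∈ stiefel n r) :
    ‖X‖ ^ 2 = r := by
  have hX' : (toMatrix X)ᵀ * toMatrix X = 1 := hX
  rw [← real_inner_self_eq_norm_sq, inner_eq_trace, hX', Matrix.trace_one, Fintype.card_fin]

theorem norm_of_mem_stiefel {n r : ℕ} {X : Mat n r} (hX : X ∈ stiefel n r) : ‖X‖ = √r := by
  rw [← norm_sq_of_mem_stiefel hX, Real.sqrt_sq (norm_nonneg _)]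

theorem isClosed_stiefel (n r : ℕ) : IsClosed (stiefel n r) :=
  isClosed_eq (continuous_toMatrix.matrix_transpose.matrix_mul continuous_toMatrix)
    continuous_const

/-- The orthogonal projection to the tangent space at a point of the Stiefel manifold. -/
noncomputable def tangentProj {n r : ℕ} (X W : Mat n r) : Mat n r :=
  W - mulRight X ((1 / 2 : ℝ) • ((toMatrix W)ᵀ * toMatrix X + (toMatrix X)ᵀ * toMatrix W))

theorem tangentProj_mem_tangent {n r : ℕ} {X : Mat n r} (hX : X ∈ stiefel n r) (W : Mat n r) :
    tangentProj X W ∈ tangent X := by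
  have hX' : (toMatrix X)ᵀ * toMatrix X = 1 := hX
  change (toMatrix (tangentProj X W))ᵀ * toMatrix X + (toMatrix X)ᵀ * toMatrix (tangentProj X W) = 0
  rw [tangentProj, map_sub, toMatrix_mulRight, Matrix.transpose_sub, Matrix.sub_mul,
    Matrix.mul_sub, Matrix.transpose_mul, Matrix.mul_assoc _ _ (toMatrix X), hX',
    ← Matrix.mul_assoc _ (toMatrix X), hX', Matrix.mul_one, Matrix.one_mul, Matrix.transpose_smul,
    Matrix.transpose_add, Matrix.transpose_mul, Matrix.transpose_mul, Matrix.transpose_transpose,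
    Matrix.transpose_transpose]
  module

theorem tangentProj_of_mem_tangent {n r : ℕ} {X W : Mat n r} (hW : W ∈ tangent X) :
    tangentProj X W = W := by
  have hW' : (toMatrix W)ᵀ * toMatrix X + (toMatrix X)ᵀ * toMatrix W = 0 := hW
  apply toMatrix_injective
  rw [tangentProj, hW', map_sub, toMatrix_mulRight, smul_zero, Matrix.mul_zero, sub_zero]

theorem continuous_tangentProj {n r : ℕ} (W : Mat n r) :
    Continuous fun X : Mat n r => tangentProj X W := by
  have h : Continuous fun X : Mat n r => (1 / 2 : ℝ) •
      ((toMatrix W)ᵀ * toMatrix X + (toMatrix X)ᵀ * toMatrix W) :=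
    ((continuous_const.matrix_mul continuous_toMatrix).add
      (continuous_toMatrix.matrix_transpose.matrix_mul continuous_const)).const_smul (1 / 2 : ℝ)
  exact continuous_const.sub (continuous_mulRight.comp (continuous_id.prodMk h))

/-- Pythagoras. It is applied where `W - normalPart X D` is `D` or `D - t • ξ`, so that the
tangential and the normal part are each bounded by the whole vector. -/
theorem norm_sq_eq_add_norm_sq_normalPart {n r : ℕ} {X D W : Mat n r} (hW : W ∈ tangent X) :
    ‖W - normalPart X D‖ ^ 2 = ‖W‖ ^ 2 + ‖normalPart X D‖ ^ 2 := by
  rw [norm_sub_sq_real, real_inner_comm, inner_normalPart_of_mem_tangent hW]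
  ring

theorem norm_le_norm_sub_normalPart {n r : ℕ} {X D W : Mat n r} (hW : W ∈ tangent X) :
    ‖W‖ ≤ ‖W - normalPart X D‖ := by
  have h := norm_sq_eq_add_norm_sq_normalPart (D := D) hW
  exact (sq_le_sq₀ (norm_nonneg _) (norm_nonneg _)).1 (by nlinarith [sq_nonneg ‖normalPart X D‖])

theorem norm_normalPart_le {n r : ℕ} {X D W : Mat n r} (hW : W ∈ tangent X) :
    ‖normalPart X D‖ ≤ ‖W - normalPart X D‖ := by
  have h := norm_sq_eq_add_norm_sq_normalPart (D := D) hW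
  exact (sq_le_sq₀ (norm_nonneg _) (norm_nonneg _)).1 (by nlinarith [sq_nonneg ‖W‖])

/-! ### Hessians and second-order expansions -/

theorem MinEigenvalueGE.mul_norm_sq_le_inner {E : Type*} [NormedAddCommGroup E]
    [InnerProductSpace ℝ E] [FiniteDimensional ℝ E] {A : E →L[ℝ] E} {c : ℝ}
    (h : MinEigenvalueGE A c) (hA : (A : E →ₗ[ℝ] E).IsSymmetric) (x : E) :
    c * ‖x‖ ^ 2 ≤ inner ℝ (A x) x := by
  let b := hA.eigenvectorBasis rfl
  have h1 : inner ℝ (A x) x = ∑ i, hA.eigenvalues rfl i * (b.repr x i) ^ 2 := by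
    rw [← b.sum_inner_mul_inner]
    refine Finset.sum_congr rfl fun i _ => ?_
    have h2 := hA.eigenvectorBasis_apply_self_apply rfl x i
    rw [real_inner_comm, ← b.repr_apply_apply, ← b.repr_apply_apply]
    have h3 : b.repr (A x) i = hA.eigenvalues rfl i * b.repr x i := by exact_mod_cast h2
    rw [h3]
    ring
  have h4 : ‖x‖ ^ 2 = ∑ i, (b.repr x i) ^ 2 := by
    rw [← b.repr.norm_map, EuclideanSpace.norm_sq_eq]
    simp
  rw [h1, h4, Finset.mul_sum]
  exact Finset.sum_le_sum fun i _ =>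
    mul_le_mul_of_nonneg_right (h _ (hA.hasEigenvalue_eigenvalues rfl i)) (sq_nonneg _)

section Hessian

variable {E : Type*} [NormedAddCommGroup E] [InnerProductSpace ℝ E] [CompleteSpace E]

theorem contDiff_one_gradient {g : E → ℝ} (hg : ContDiff ℝ 2 g) : ContDiff ℝ 1 (gradient g) :=
  (InnerProductSpace.toDual ℝ E).symm.toContinuousLinearEquiv.contDiff.comp
    (hg.fderiv_right (by norm_num))

theorem inner_hessian {g : E → ℝ} (hg : ContDiff ℝ 2 g) (x u v : E) :
    inner ℝ (hessian g x u) v = fderiv ℝ (fderiv ℝ g) x u v := by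
  have h1 : HasFDerivAt (fderiv ℝ g) (fderiv ℝ (fderiv ℝ g) x) x :=
    ((hg.fderiv_right (m := 1) (by norm_num)).differentiable one_ne_zero x).hasFDerivAt
  have h2 := ((InnerProductSpace.toDual ℝ E).symm.toContinuousLinearEquiv.hasFDerivAt
    (x := fderiv ℝ g x)).comp x h1
  have h3 : hessian g x = _ := h2.fderiv
  rw [h3]
  exact InnerProductSpace.toDual_symm_apply

theorem isSymmetric_hessian {g : E → ℝ} (hg : ContDiff ℝ 2 g) (x : E) :
    (hessian g x : E →ₗ[ℝ] E).IsSymmetric := by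
  intro u v
  change inner ℝ (hessian g x u) v = inner ℝ u (hessian g x v)
  rw [real_inner_comm (hessian g x v), inner_hessian hg, inner_hessian hg]
  exact (hg.contDiffAt.isSymmSndFDerivAt (by simp)) u v

theorem hasDerivAt_comp_add_smul {g : E → ℝ} (hg : Differentiable ℝ g) (x v : E) (t : ℝ) :
    HasDerivAt (fun s : ℝ => g (x + s • v)) (inner ℝ (gradient g (x + t • v)) v) t := by
  have h1 : HasDerivAt (fun s : ℝ => x + s • v) v t := by
    simpa using ((hasDerivAt_id t).smul_const v).const_add x
  have h2 := (hg (x + t • v)).hasFDerivAt.comp_hasDerivAt t h1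
  rw [inner_gradient_left]
  exact h2

/-- The second-order expansion of a `C²` function, uniform in both end points. -/
theorem eventually_abs_taylor_two_le {g : E → ℝ} (hg : ContDiff ℝ 2 g) (x₀ : E) {ε : ℝ}
    (hε : 0 < ε) :
    ∀ᶠ p : E × E in 𝓝 (x₀, x₀),
      |g p.2 - g p.1 - inner ℝ (gradient g p.1) (p.2 - p.1) -
        inner ℝ (hessian g x₀ (p.2 - p.1)) (p.2 - p.1) / 2| ≤ ε * ‖p.2 - p.1‖ ^ 2 := by
  -- Strict differentiability compares the gradients at two arbitrary points near `x₀` through the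
  -- one operator `hessian g x₀`; this makes the remainder uniform in both end points. The mean
  -- value inequality for the Taylor remainder `ψ` along the segment then finishes.
  have hs : HasStrictFDerivAt (gradient g) (hessian g x₀) x₀ :=
    (contDiff_one_gradient hg).hasStrictFDerivAt one_ne_zero
  have hb := hs.isLittleO.bound hε
  obtain ⟨δ, hδ, hball⟩ := Metric.eventually_nhds_iff_ball.1 hb
  refine Metric.eventually_nhds_iff_ball.2 ⟨δ, hδ, ?_⟩
  rintro ⟨x, y⟩ hxy
  rw [← ball_prod_same] at hxy
  obtain ⟨hx, hy⟩ := hxy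
  dsimp only at hx hy ⊢
  set v := y - x with hv
  let ψ : ℝ → ℝ := fun t => g (x + t • v) - t * inner ℝ (gradient g x) v -
    t ^ 2 * (inner ℝ (hessian g x₀ v) v / 2)
  have hψ : ∀ t : ℝ, HasDerivAt ψ (inner ℝ (gradient g (x + t • v)) v -
      1 * inner ℝ (gradient g x) v - (2 * t) * (inner ℝ (hessian g x₀ v) v / 2)) t := by
    intro t
    refine ((hasDerivAt_comp_add_smul (hg.differentiable two_ne_zero) x v t).sub
      ((hasDerivAt_id t).mul_const _)).sub ?_
    simpa using (hasDerivAt_pow 2 t).mul_const (inner ℝ (hessian g x₀ v) v / 2)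
  have hbound : ∀ t ∈ Set.Ico (0 : ℝ) 1, ‖inner ℝ (gradient g (x + t • v)) v -
      1 * inner ℝ (gradient g x) v - (2 * t) * (inner ℝ (hessian g x₀ v) v / 2)‖ ≤
        ε * ‖v‖ ^ 2 := by
    intro t ht
    have hmem : x + t • v ∈ Metric.ball x₀ δ := by
      have := (convex_ball x₀ δ).add_smul_sub_mem hx hy ⟨ht.1, ht.2.le⟩
      exact this
    have h1 := hball (x + t • v, x) (by rw [← ball_prod_same]; exact ⟨hmem, hx⟩)
    simp only [add_sub_cancel_left, map_smul] at h1
    have h2 : inner ℝ (gradient g (x + t • v)) v - 1 * inner ℝ (gradient g x) v -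
        (2 * t) * (inner ℝ (hessian g x₀ v) v / 2) =
        inner ℝ (gradient g (x + t • v) - gradient g x - t • hessian g x₀ v) v := by
      rw [inner_sub_left, inner_sub_left, real_inner_smul_left]
      ring
    rw [h2]
    refine (norm_inner_le_norm _ _).trans ?_
    have h3 : ‖t • v‖ ≤ ‖v‖ := by
      rw [norm_smul, Real.norm_of_nonneg ht.1]
      exact mul_le_of_le_one_left (norm_nonneg _) ht.2.le
    calc _ ≤ (ε * ‖t • v‖) * ‖v‖ := mul_le_mul_of_nonneg_right h1 (norm_nonneg _)
      _ ≤ (ε * ‖v‖) * ‖v‖ := by gcongr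
      _ = ε * ‖v‖ ^ 2 := by ring
  have key := norm_image_sub_le_of_norm_deriv_le_segment_01'
    (fun t _ => (hψ t).hasDerivWithinAt) hbound
  have h0 : ψ 0 = g x := by simp [ψ]
  have h1 : ψ 1 = g y - inner ℝ (gradient g x) v - inner ℝ (hessian g x₀ v) v / 2 := by
    simp [ψ, hv]
  rw [h0, h1, Real.norm_eq_abs] at key
  convert key using 2
  ring

/-- The descent lemma, for points at any distance. -/
theorem le_of_lipschitzWith_gradient {g : E → ℝ} (hg : Differentiable ℝ g) {L : ℝ≥0}
    (hL : LipschitzWith L (gradient g)) (x y : E) :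
    |g y - g x - inner ℝ (gradient g x) (y - x)| ≤ L * ‖y - x‖ ^ 2 := by
  set v := y - x with hv
  let ψ : ℝ → ℝ := fun t => g (x + t • v) - t * inner ℝ (gradient g x) v
  have hψ : ∀ t : ℝ, HasDerivAt ψ (inner ℝ (gradient g (x + t • v)) v -
      1 * inner ℝ (gradient g x) v) t := fun t =>
    (hasDerivAt_comp_add_smul hg x v t).sub ((hasDerivAt_id t).mul_const _)
  have hbound : ∀ t ∈ Set.Ico (0 : ℝ) 1, ‖inner ℝ (gradient g (x + t • v)) v -
      1 * inner ℝ (gradient g x) v‖ ≤ L * ‖v‖ ^ 2 := by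
    intro t ht
    have h1 := hL.norm_sub_le (x + t • v) x
    rw [add_sub_cancel_left] at h1
    rw [one_mul, ← inner_sub_left]
    refine (norm_inner_le_norm _ _).trans ?_
    have h3 : ‖t • v‖ ≤ ‖v‖ := by
      rw [norm_smul, Real.norm_of_nonneg ht.1]
      exact mul_le_of_le_one_left (norm_nonneg _) ht.2.le
    calc _ ≤ (L * ‖t • v‖) * ‖v‖ := mul_le_mul_of_nonneg_right h1 (norm_nonneg _)
      _ ≤ (L * ‖v‖) * ‖v‖ := by gcongr
      _ = L * ‖v‖ ^ 2 := by ring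
  have key := norm_image_sub_le_of_norm_deriv_le_segment_01'
    (fun t _ => (hψ t).hasDerivWithinAt) hbound
  have h0 : ψ 0 = g x := by simp [ψ]
  have h1 : ψ 1 = g y - inner ℝ (gradient g x) v := by simp [ψ, hv]
  rw [h0, h1, Real.norm_eq_abs] at key
  convert key using 2
  ring

end Hessian

open Filter

theorem inner_apply_smul_smul {E : Type*} [NormedAddCommGroup E] [InnerProductSpace ℝ E]
    (A : E →L[ℝ] E) (t : ℝ) (v : E) :
    inner ℝ (A (t • v)) (t • v) = t ^ 2 * inner ℝ (A v) v := by
  rw [map_smul, real_inner_smul_left, real_inner_smul_right]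
  ring

/-! ### Second-order behaviour of a retraction -/

section Retraction

variable {n r : ℕ} {R : Mat n r → Mat n r → Mat n r}

theorem IsRetraction.contDiff (hR : IsRetraction R) {X : Mat n r} (hX : X ∈ stiefel n r) :
    ContDiff ℝ ∞ (fun ξ : tangent X => R X ξ) := by
  have h1 : ContDiff ℝ ∞ (fun ξ : tangent X => ((X, (ξ : Mat n r)) : Mat n r × Mat n r)) :=
    contDiff_const.prodMk (tangent X).subtypeL.contDiff
  rw [← contDiffOn_univ] at h1 ⊢
  exact hR.smooth.comp h1 fun ξ _ => ⟨hX, ξ.2⟩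

theorem IsRetraction.contDiff_comp (hR : IsRetraction R) {f : Mat n r → ℝ}
    (hf : ContDiff ℝ 2 f) {X : Mat n r} (hX : X ∈ stiefel n r) :
    ContDiff ℝ 2 (fun ξ : tangent X => f (R X ξ)) :=
  hf.comp ((hR.contDiff hX).of_le (WithTop.coe_le_coe.2 le_top))

theorem IsRetraction.inner_gradient_comp (hR : IsRetraction R) {f : Mat n r → ℝ}
    (hf : Differentiable ℝ f) {X : Mat n r} (hX : X ∈ stiefel n r) (ξ : tangent X) :
    inner ℝ (gradient (fun ξ : tangent X => f (R X ξ)) 0) ξ =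
      inner ℝ (gradient f X) (ξ : Mat n r) := by
  have h0 : R X ((0 : tangent X) : Mat n r) = X := hR.zero X hX
  have h1 : HasFDerivAt f (fderiv ℝ f X) (R X ((0 : tangent X) : Mat n r)) := by
    rw [h0]
    exact (hf X).hasFDerivAt
  have h2 := h1.comp (0 : tangent X) (hR.deriv_zero X hX)
  have h3 : fderiv ℝ (fun ξ : tangent X => f (R X ξ)) 0 = _ := h2.fderiv
  rw [inner_gradient_left, inner_gradient_left, h3]
  rfl

variable {M₂ : ℝ} {X : Mat n r}

/-- The secant of the curve `t ↦ R X (t ξ)`. -/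
theorem norm_secant_sub_le (hX : X ∈ stiefel n r)
    (hRM₂ : ∀ Y ∈ stiefel n r, ∀ ξ ∈ tangent Y, ‖R Y ξ - Y - ξ‖ ≤ M₂ * ‖ξ‖ ^ 2)
    {ξ : Mat n r} (hξ : ξ ∈ tangent X) {t : ℝ} (ht : 0 < t) :
    ‖t⁻¹ • (R X (t • ξ) - X) - ξ‖ ≤ t * (M₂ * ‖ξ‖ ^ 2) := by
  have h1 := hRM₂ X hX (t • ξ) ((tangent X).smul_mem t hξ)
  have h2 : t⁻¹ • (R X (t • ξ) - X) - ξ = t⁻¹ • (R X (t • ξ) - X - t • ξ) := by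
    rw [smul_sub t⁻¹ (_ - _), inv_smul_smul₀ ht.ne']
  rw [h2, norm_smul, Real.norm_of_nonneg (inv_nonneg.2 ht.le), inv_mul_le_iff₀ ht]
  rw [norm_smul, Real.norm_of_nonneg ht.le] at h1
  linarith

theorem tendsto_secant (hX : X ∈ stiefel n r)
    (hRM₂ : ∀ Y ∈ stiefel n r, ∀ ξ ∈ tangent Y, ‖R Y ξ - Y - ξ‖ ≤ M₂ * ‖ξ‖ ^ 2)
    {ξ : Mat n r} (hξ : ξ ∈ tangent X) :
    Tendsto (fun t : ℝ => t⁻¹ • (R X (t • ξ) - X)) (𝓝[>] 0) (𝓝 ξ) := by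
  rw [tendsto_iff_norm_sub_tendsto_zero]
  have h0 : Tendsto (fun t : ℝ => t * (M₂ * ‖ξ‖ ^ 2)) (𝓝[>] 0) (𝓝 0) := by
    have : Tendsto (fun t : ℝ => t * (M₂ * ‖ξ‖ ^ 2)) (𝓝 0) (𝓝 (0 * (M₂ * ‖ξ‖ ^ 2))) :=
      (continuous_id.mul continuous_const).tendsto 0
    rw [zero_mul] at this
    exact this.mono_left nhdsWithin_le_nhds
  refine squeeze_zero' (Eventually.of_forall fun _ => norm_nonneg _) ?_ h0
  filter_upwards [self_mem_nhdsWithin] with t ht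
  exact norm_secant_sub_le hX hRM₂ hξ ht

/-- The curvature of the Stiefel manifold bounds the second-order constant of every retraction
from below. -/
theorem norm_normalPart_le_mul (hR : IsRetraction R) (hX : X ∈ stiefel n r)
    (hRM₂ : ∀ Y ∈ stiefel n r, ∀ ξ ∈ tangent Y, ‖R Y ξ - Y - ξ‖ ≤ M₂ * ‖ξ‖ ^ 2)
    {ξ : Mat n r} (hξ : ξ ∈ tangent X) : ‖normalPart X ξ‖ ≤ M₂ * ‖ξ‖ ^ 2 := by
  have hc : Continuous fun u : Mat n r => ‖normalPart X u‖ :=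
    (continuous_normalPart.comp (continuous_const.prodMk continuous_id)).norm
  -- The secants tend to `ξ`, so it suffices to bound `normalPart` on them. The normal component of
  -- `D - t • ξ` is `-normalPart X D`, hence has norm at most `M₂ t² ‖ξ‖²`; dividing by `t²` uses
  -- the quadratic homogeneity of `normalPart`.
  refine le_of_tendsto ((hc.tendsto ξ).comp (tendsto_secant hX hRM₂ hξ)) ?_
  filter_upwards [self_mem_nhdsWithin] with t ht
  have ht : 0 < t := ht
  set D := R X (t • ξ) - X with hD
  have htξ := (tangent X).smul_mem t hξ
  have hW := (tangent X).sub_mem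
    (sub_add_normalPart_mem_tangent hX (hR.mapsTo X hX _ htξ)) htξ
  rw [← hD] at hW
  have h1 := norm_normalPart_le (D := D) hW
  have h2 : D + normalPart X D - t • ξ - normalPart X D = D - t • ξ := by abel
  have h3 := hRM₂ X hX (t • ξ) htξ
  rw [norm_smul, Real.norm_of_nonneg ht.le] at h3
  rw [h2] at h1
  simp only [Function.comp, normalPart_smul, norm_smul, Real.norm_eq_abs, abs_pow, abs_inv,
    abs_of_pos ht]
  rw [inv_pow, inv_mul_le_iff₀ (by positivity)]
  linarith

/-- The Hessian of `f` along a retraction is bounded by the Riemannian Hessian up to the effect of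
the tangential acceleration of the retraction. -/
theorem inner_hessian_comp_le (hR : IsRetraction R) (hX : X ∈ stiefel n r)
    (hRM₂ : ∀ Y ∈ stiefel n r, ∀ ξ ∈ tangent Y, ‖R Y ξ - Y - ξ‖ ≤ M₂ * ‖ξ‖ ^ 2)
    {f : Mat n r → ℝ} (hf : ContDiff ℝ 2 f) {c : ℝ} (hc : 0 ≤ c)
    (hgrad : ∀ U ∈ tangent X, inner ℝ (gradient f X) U ≤ c * ‖U‖) (ξ : tangent X) :
    inner ℝ (hessian (fun ξ : tangent X => f (R X ξ)) 0 ξ) ξ / 2 ≤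
      c * (M₂ * ‖ξ‖ ^ 2) - inner ℝ (gradient f X) (normalPart X ξ) +
        inner ℝ (hessian f X ξ) (ξ : Mat n r) / 2 := by
  refine le_of_forall_pos_le_add fun δ hδ => ?_
  -- The remainder `ε` enters twice, through the expansions of `f` and of `f ∘ R`. The `+ 1` in the
  -- witness covers `ξ = 0`.
  obtain ⟨ε, hε, hεδ⟩ : ∃ ε > 0, 2 * ε * ‖ξ‖ ^ 2 ≤ δ := by
    refine ⟨δ / (2 * (‖ξ‖ ^ 2 + 1)), by positivity, ?_⟩
    rw [mul_div_assoc', div_mul_eq_mul_div, div_le_iff₀ (by positivity)]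
    nlinarith
  set g : tangent X → ℝ := fun ξ => f (R X ξ) with hg
  let u : ℝ → Mat n r := fun t => t⁻¹ • (R X (t • (ξ : Mat n r)) - X)
  have hu : Tendsto u (𝓝[>] 0) (𝓝 ξ) := tendsto_secant hX hRM₂ ξ.2
  have hcont : Continuous fun v : Mat n r =>
      c * (M₂ * ‖(ξ : Mat n r)‖ ^ 2) - inner ℝ (gradient f X) (normalPart X v) +
        inner ℝ (hessian f X v) v / 2 + ε * ‖v‖ ^ 2 := by
    have h1 : Continuous fun v : Mat n r => normalPart X v :=
      continuous_normalPart.comp (continuous_const.prodMk continuous_id)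
    fun_prop
  have hlim := (hcont.tendsto ξ).comp hu
  suffices hle : inner ℝ (hessian g 0 ξ) ξ / 2 - ε * ‖ξ‖ ^ 2 ≤
      c * (M₂ * ‖(ξ : Mat n r)‖ ^ 2) - inner ℝ (gradient f X) (normalPart X ξ) +
        inner ℝ (hessian f X ξ) (ξ : Mat n r) / 2 + ε * ‖(ξ : Mat n r)‖ ^ 2 by
    rw [Submodule.coe_norm] at hle hεδ ⊢
    linarith
  refine ge_of_tendsto hlim ?_
  have hcurve : Tendsto (fun t : ℝ => (X, R X (t • (ξ : Mat n r)))) (𝓝[>] 0) (𝓝 (X, X)) := by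
    have h1 : Continuous fun t : ℝ => (X, R X (t • (ξ : Mat n r))) :=
      continuous_const.prodMk ((hR.contDiff hX).continuous.comp
        (continuous_id.smul (continuous_const (y := ξ))))
    have h2 := h1.tendsto 0
    rw [zero_smul, hR.zero X hX] at h2
    exact h2.mono_left nhdsWithin_le_nhds
  have hline : Tendsto (fun t : ℝ => ((0 : tangent X), t • ξ)) (𝓝[>] 0) (𝓝 (0, 0)) := by
    have h1 : Continuous fun t : ℝ => ((0 : tangent X), t • ξ) := by fun_prop
    have h2 := h1.tendsto 0
    rw [zero_smul] at h2
    exact h2.mono_left nhdsWithin_le_nhds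
  filter_upwards [self_mem_nhdsWithin,
    hcurve.eventually (eventually_abs_taylor_two_le hf X hε),
    hline.eventually (eventually_abs_taylor_two_le (hR.contDiff_comp hf hX) 0 hε)] with t ht hF hG
  have ht : 0 < t := ht
  have htξ := (tangent X).smul_mem t ξ.2
  set D := R X (t • (ξ : Mat n r)) - X with hD
  have hDu : D = t • u t := by simp only [u, smul_inv_smul₀ ht.ne', hD]
  -- Split `D - t • ξ` into a tangent vector and `-normalPart X D`. The tangent vector is no longer
  -- than `D - t • ξ`, so `hgrad` controls its contribution; the normal contribution is kept
  -- exactly.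
  have hinner : inner ℝ (gradient f X) (D - t • (ξ : Mat n r)) ≤
      c * (M₂ * (t * ‖(ξ : Mat n r)‖) ^ 2) - inner ℝ (gradient f X) (normalPart X D) := by
    have hW := (tangent X).sub_mem
      (sub_add_normalPart_mem_tangent hX (hR.mapsTo X hX _ htξ)) htξ
    rw [← hD] at hW
    have h1 := norm_le_norm_sub_normalPart (D := D) hW
    have h2 : D + normalPart X D - t • (ξ : Mat n r) - normalPart X D = D - t • ξ := by abel
    have h3 := hRM₂ X hX (t • ξ) htξ
    rw [norm_smul, Real.norm_of_nonneg ht.le] at h3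
    rw [h2] at h1
    have h4 := hgrad _ hW
    have h5 : D + normalPart X D - t • (ξ : Mat n r) = D - t • ξ + normalPart X D := by abel
    have h6 := mul_le_mul_of_nonneg_left (h1.trans h3) hc
    nth_rw 1 [h5] at h4
    rw [inner_add_right] at h4
    linarith
  have hF' := (abs_le.1 hF).2
  have hG' := (abs_le.1 hG).1
  simp only [sub_zero] at hG'
  rw [hR.inner_gradient_comp (hf.differentiable two_ne_zero) hX] at hG'
  have hg0 : f (R X ((0 : tangent X) : Mat n r)) = f X := by
    rw [Submodule.coe_zero, hR.zero X hX]
  simp only [hg0, Submodule.coe_smul] at hG'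
  rw [inner_sub_right] at hinner
  rw [hDu, inner_apply_smul_smul] at hF'
  rw [hDu] at hinner
  rw [inner_apply_smul_smul] at hG'
  simp only [normalPart_smul, inner_smul_right, norm_smul,
    Real.norm_of_nonneg ht.le] at hF' hG' hinner
  change inner ℝ (hessian g 0 ξ) ξ / 2 - ε * ‖ξ‖ ^ 2 ≤ _
  change _ ≤ _ - t ^ 2 * inner ℝ (hessian g 0 ξ) ξ / 2 at hG'
  simp only [Function.comp]
  have ht2 : 0 < t ^ 2 := by positivity
  refine le_of_mul_le_mul_left ?_ ht2
  nlinarith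

end Retraction

/-! ### Quadratic growth along chords near a stationary point -/

/-- The second-order part of the growth of `f + h` along chords from `X`. -/
noncomputable def chordForm {n r : ℕ} (f : Mat n r → ℝ) (A : Mat n r →L[ℝ] Mat n r) (c : ℝ)
    (X D : Mat n r) : ℝ :=
  inner ℝ (A D) D / 2 - inner ℝ (gradient f X) (normalPart X D) - c * ‖normalPart X D‖

theorem chordForm_smul {n r : ℕ} (f : Mat n r → ℝ) (A : Mat n r →L[ℝ] Mat n r) (c : ℝ)
    (X D : Mat n r) (t : ℝ) : chordForm f A c X (t • D) = t ^ 2 * chordForm f A c X D := by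
  simp only [chordForm, normalPart_smul, map_smul, inner_smul_left, inner_smul_right, norm_smul,
    RCLike.conj_to_real, Real.norm_eq_abs, abs_pow, sq_abs]
  ring

theorem continuous_chordForm {n r : ℕ} {f : Mat n r → ℝ} (hf : Continuous (gradient f))
    (A : Mat n r →L[ℝ] Mat n r) (c : ℝ) {α : Type*} [TopologicalSpace α] {a b : α → Mat n r}
    (ha : Continuous a) (hb : Continuous b) : Continuous fun q => chordForm f A c (a q) (b q) := by
  have hn : Continuous fun q => normalPart (a q) (b q) := continuous_normalPart.comp (ha.prodMk hb)
  have hg : Continuous fun q => gradient f (a q) := hf.comp ha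
  have hA : Continuous fun q => A (b q) := A.continuous.comp hb
  exact (((hA.inner hb).div_const 2).sub (hg.inner hn)).sub (hn.norm.const_mul c)

/-- The bilinear expression that vanishes at the chords `D = Y - X` of the Stiefel manifold. -/
def chordDefect {n r : ℕ} (X Y D : Mat n r) : Matrix (Fin r) (Fin r) ℝ :=
  (toMatrix D)ᵀ * toMatrix X + (toMatrix Y)ᵀ * toMatrix D

theorem continuous_chordDefect {n r : ℕ} :
    Continuous fun q : (Mat n r × Mat n r) × Mat n r => chordDefect q.1.1 q.1.2 q.2 := by
  have h0 := continuous_toMatrix (n := n) (r := r)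
  exact ((h0.comp continuous_snd).matrix_transpose.matrix_mul
    (h0.comp (continuous_fst.comp continuous_fst))).add
    ((h0.comp (continuous_snd.comp continuous_fst)).matrix_transpose.matrix_mul
    (h0.comp continuous_snd))

theorem chordDefect_smul {n r : ℕ} (X Y D : Mat n r) (t : ℝ) :
    chordDefect X Y (t • D) = t • chordDefect X Y D := by
  simp only [chordDefect, map_smul, Matrix.transpose_smul, Matrix.smul_mul, Matrix.mul_smul,
    smul_add]

/-- A lower bound of the chord form on unit tangent vectors extends to short chords. -/
theorem eventually_mul_norm_sq_le_chordForm {n r : ℕ} {f : Mat n r → ℝ}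
    (hf : Continuous (gradient f)) (A : Mat n r →L[ℝ] Mat n r) (c : ℝ) {a : ℝ} {X₀ : Mat n r}
    (hpos : ∀ ξ ∈ tangent X₀, ‖ξ‖ = 1 → a < chordForm f A c X₀ ξ) :
    ∀ᶠ p : Mat n r × Mat n r in 𝓝 (X₀, X₀), p.1 ∈ stiefel n r → p.2 ∈ stiefel n r →
      a * ‖p.2 - p.1‖ ^ 2 ≤ chordForm f A c p.1 (p.2 - p.1) := by
  have hΦ : Continuous fun q : (Mat n r × Mat n r) × Mat n r => chordForm f A c q.1.1 q.2 :=
    continuous_chordForm hf A c (continuous_fst.comp continuous_fst) continuous_snd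
  have hC : IsClosed {q : (Mat n r × Mat n r) × Mat n r | chordDefect q.1.1 q.1.2 q.2 = 0} :=
    isClosed_eq continuous_chordDefect continuous_const
  have hO₁ := hC.isOpen_compl
  have hO₂ : IsOpen {q : (Mat n r × Mat n r) × Mat n r | a < chordForm f A c q.1.1 q.2} :=
    isOpen_lt continuous_const hΦ
  have hO := hO₁.union hO₂
  -- Over `(X₀, X₀)` the defect vanishes exactly on tangent vectors, where `hpos` applies. The union
  -- of the two open conditions thus covers the compact unit sphere, and the tube lemma extends this
  -- to nearby pairs; true chords have zero defect, which leaves only the lower bound.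
  have hsub : ({(X₀, X₀)} : Set (Mat n r × Mat n r)) ×ˢ Metric.sphere (0 : Mat n r) 1 ⊆
      {q | chordDefect q.1.1 q.1.2 q.2 = 0}ᶜ ∪ {q | a < chordForm f A c q.1.1 q.2} := by
    rintro ⟨p, u⟩ ⟨hp, hu⟩
    rw [Set.mem_singleton_iff] at hp
    subst hp
    by_cases hu' : u ∈ tangent X₀
    · exact Or.inr (hpos u hu' (by simpa using hu))
    · exact Or.inl fun h => hu' h
  obtain ⟨U, S, hU, -, hXU, hS, hUS⟩ :=
    generalized_tube_lemma isCompact_singleton (isCompact_sphere (0 : Mat n r) 1) hO hsub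
  filter_upwards [hU.mem_nhds (hXU rfl)] with p hp h1 h2
  set D := p.2 - p.1 with hD
  by_cases hD0 : D = 0
  · rw [hD0]
    have := chordForm_smul f A c p.1 0 0
    rw [zero_smul, zero_pow two_ne_zero, zero_mul] at this
    rw [this, norm_zero, zero_pow two_ne_zero, mul_zero]
  have hDn : ‖D‖ ≠ 0 := norm_ne_zero_iff.2 hD0
  have hDu : D = ‖D‖ • (‖D‖⁻¹ • D) := by rw [smul_inv_smul₀ hDn]
  have hunit : ‖D‖⁻¹ • D ∈ Metric.sphere (0 : Mat n r) 1 := by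
    rw [mem_sphere_zero_iff_norm, norm_smul, norm_inv, norm_norm, inv_mul_cancel₀ hDn]
  have hmem := hUS (Set.mk_mem_prod hp (hS hunit))
  have he0 : chordDefect p.1 p.2 (‖D‖⁻¹ • D) = 0 := by
    rw [chordDefect_smul, chordDefect, hD, chord_eq h1 h2, smul_zero]
  rcases hmem with hmem | hmem
  · exact absurd he0 hmem
  · have hlt : a < chordForm f A c p.1 (‖D‖⁻¹ • D) := hmem
    rw [hDu, chordForm_smul, ← hDu, mul_comm]
    exact mul_le_mul_of_nonneg_left hlt.le (sq_nonneg _)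

/-- A first-order stationarity condition of `f + h` on the Stiefel manifold: `0` solves the
linearized problem on the tangent space. -/
def IsStationary {n r : ℕ} (f h : Mat n r → ℝ) (X : Mat n r) : Prop :=
  ∀ W ∈ tangent X, h X ≤ inner ℝ (gradient f X) W + h (X + W)

/-- Test stationarity with `-U`: the first-order change of `f` is balanced by a change of `h` of
size at most `Lh * ‖U‖`. -/
theorem IsStationary.inner_gradient_le {n r : ℕ} {f h : Mat n r → ℝ} {X : Mat n r}
    (hX : IsStationary f h X) {Lh : ℝ≥0} (hhL : LipschitzWith Lh h) (U : Mat n r)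
    (hU : U ∈ tangent X) : inner ℝ (gradient f X) U ≤ Lh * ‖U‖ := by
  have h1 := hX (-U) ((tangent X).neg_mem hU)
  have h2 := hhL.le_add_mul (X + -U) X
  rw [dist_eq_norm, add_sub_cancel_left, norm_neg] at h2
  rw [inner_neg_right] at h1
  linarith

/-- Near a stationary point with a nondegenerate Hessian, `f + h` has quadratic growth, relative to
its linearization at any nearby point. -/
theorem exists_eventually_growth {n r : ℕ} {f h : Mat n r → ℝ} {R : Mat n r → Mat n r → Mat n r}
    (hR : IsRetraction R) (hf : ContDiff ℝ 2 f) {Lh : ℝ≥0} (hhL : LipschitzWith Lh h)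
    {M₂ : ℝ}
    (hRM₂ : ∀ Y ∈ stiefel n r, ∀ ξ ∈ tangent Y, ‖R Y ξ - Y - ξ‖ ≤ M₂ * ‖ξ‖ ^ 2)
    {Xs : Mat n r} (hXs : Xs ∈ stiefel n r) (hstat : IsStationary f h Xs)
    {η : ℝ} (hη : 4 * (Lh : ℝ) * M₂ < η)
    (hHess : MinEigenvalueGE (hessian (fun ξ : tangent Xs => f (R Xs ξ)) 0) η) :
    ∃ c > 0, ∀ᶠ p : Mat n r × Mat n r in 𝓝 (Xs, Xs), p.1 ∈ stiefel n r → p.2 ∈ stiefel n r →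
      f p.1 + inner ℝ (gradient f p.1) (p.2 - p.1 + normalPart p.1 (p.2 - p.1)) +
        h (p.1 + (p.2 - p.1 + normalPart p.1 (p.2 - p.1))) + c * ‖p.2 - p.1‖ ^ 2 ≤
          f p.2 + h p.2 := by
  -- The form is at least `η / 2 - 2 Lh M₂ = 4 c` on unit tangent vectors. Half of this is given up
  -- for strictness in the compactness argument, a further `c` pays for the Taylor remainder, and
  -- `c` is left.
  obtain ⟨c, hc⟩ : ∃ c, c = (η - 4 * (Lh : ℝ) * M₂) / 8 := ⟨_, rfl⟩
  have hc0 : 0 < c := by rw [hc]; linarith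
  have hpos : ∀ ξ ∈ tangent Xs, ‖ξ‖ = 1 →
      2 * c < chordForm f (hessian f Xs) Lh Xs ξ := by
    intro ξ hξ hn
    have h1 := inner_hessian_comp_le hR hXs hRM₂ hf Lh.2 (hstat.inner_gradient_le hhL) ⟨ξ, hξ⟩
    have h2 := hHess.mul_norm_sq_le_inner (isSymmetric_hessian (hR.contDiff_comp hf hXs) 0)
      ⟨ξ, hξ⟩
    have h3 := norm_normalPart_le_mul hR hXs hRM₂ hξ
    rw [Submodule.coe_norm] at h1 h2
    simp only [hn, one_pow, mul_one] at h1 h2 h3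
    have h4 := mul_le_mul_of_nonneg_left h3 Lh.2
    unfold chordForm
    change _ ≤ (Lh : ℝ) * M₂ - _ + _ at h1
    change (Lh : ℝ) * _ ≤ (Lh : ℝ) * _ at h4
    linarith
  refine ⟨c, hc0, ?_⟩
  filter_upwards [eventually_mul_norm_sq_le_chordForm
    (contDiff_one_gradient hf).continuous (hessian f Xs) Lh hpos,
    eventually_abs_taylor_two_le hf Xs hc0] with p h1 h2 hp1 hp2
  have h1 := h1 hp1 hp2
  have h2 := (abs_le.1 h2).1
  have h3 := hhL.le_add_mul (p.1 + (p.2 - p.1 + normalPart p.1 (p.2 - p.1))) p.2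
  have h4 : p.1 + (p.2 - p.1 + normalPart p.1 (p.2 - p.1)) - p.2 = normalPart p.1 (p.2 - p.1) := by
    abel
  rw [dist_eq_norm, h4] at h3
  unfold chordForm at h1
  rw [inner_add_right]
  linarith

/-! ### Sequences that decrease relative to a window maximum -/

section Window

variable {m : ℕ} {a : ℕ → ℝ} {l : ℕ → ℕ}

theorem IsWindowArgmax.le_self (hl : IsWindowArgmax m a l) (k : ℕ) : l k ≤ k :=
  (Finset.mem_Icc.1 (hl k).1).2

theorem IsWindowArgmax.le_add (hl : IsWindowArgmax m a l) (k : ℕ) : k ≤ l k + m := by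
  have := (Finset.mem_Icc.1 (hl k).1).1
  omega

theorem IsWindowArgmax.apply_le (hl : IsWindowArgmax m a l) {j k : ℕ} (h1 : k ≤ j + m)
    (h2 : j ≤ k) : a j ≤ a (l k) :=
  (hl k).2 j (Finset.mem_Icc.2 ⟨by omega, h2⟩)

theorem IsWindowArgmax.windowMax_eq (hl : IsWindowArgmax m a l) (k : ℕ) :
    windowMax m a k = a (l k) :=
  le_antisymm (Finset.sup'_le _ _ (hl k).2) (Finset.le_sup' a (hl k).1)

/-- The only index that can enter when the window moves from `k` to `k + 1` is `k + 1`, whose value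
`hdec` bounds. -/
theorem IsWindowArgmax.antitone (hl : IsWindowArgmax m a l)
    (hdec : ∀ k, a (k + 1) ≤ a (l k)) : Antitone fun k => a (l k) := by
  refine antitone_nat_of_succ_le fun k => ?_
  have h1 := hl.le_self (k + 1)
  have h2 := hl.le_add (k + 1)
  rcases Nat.lt_or_ge k (l (k + 1)) with h | h
  · rw [show l (k + 1) = k + 1 by omega]
    exact hdec k
  · exact hl.apply_le (by omega) h

/-- The values along a nonmonotone descent converge, and the steps tend to zero. -/
theorem IsWindowArgmax.tendsto_of_decrease (hl : IsWindowArgmax m a l) {d : ℕ → ℝ} {c C b : ℝ}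
    (hc : 0 < c) (hdec : ∀ k, a (k + 1) ≤ a (l k) - c * d k ^ 2)
    (hlip : ∀ k, |a (k + 1) - a k| ≤ C * |d k|)
    (hlim : Tendsto (fun k => a (l k)) atTop (𝓝 b)) :
    Tendsto a atTop (𝓝 b) ∧ Tendsto d atTop (𝓝 0) := by
  have hlt : Tendsto l atTop atTop :=
    tendsto_atTop_mono (fun k => (by have := hl.le_add k; omega : k - m ≤ l k))
      (tendsto_sub_atTop_nat m)
  -- At the index `l k - (j + 1)`, the sufficient decrease bounds `c * d ^ 2` by the gap between a
  -- window maximum and `a (l k - j)`; both tend to `b`. The Lipschitz bound `hlip` then moves the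
  -- limit of `a` one index back, which drives the induction in `hval`.
  have hstep : ∀ j, Tendsto (fun k => a (l k - j)) atTop (𝓝 b) →
      Tendsto (fun k => d (l k - (j + 1))) atTop (𝓝 0) := by
    intro j hj
    have h1 : Tendsto (fun k => l k - (j + 1)) atTop atTop :=
      (tendsto_sub_atTop_nat (j + 1)).comp hlt
    have h2 : Tendsto (fun k => (a (l (l k - (j + 1))) - a (l k - j)) / c) atTop
        (𝓝 ((b - b) / c)) := ((hlim.comp h1).sub hj).div_const c
    rw [sub_self, zero_div] at h2
    have h3 : Tendsto (fun k => d (l k - (j + 1)) ^ 2) atTop (𝓝 0) := by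
      refine squeeze_zero' (Eventually.of_forall fun _ => sq_nonneg _) ?_ h2
      filter_upwards [hlt.eventually_ge_atTop (j + 1)] with k hk
      have h4 := hdec (l k - (j + 1))
      rw [show l k - (j + 1) + 1 = l k - j by omega] at h4
      rw [le_div_iff₀ hc]
      linarith
    refine (tendsto_zero_iff_abs_tendsto_zero _).2 ?_
    have h5 := h3.sqrt
    simp only [Real.sqrt_sq_eq_abs, Real.sqrt_zero] at h5
    exact h5
  have hval : ∀ j, Tendsto (fun k => a (l k - j)) atTop (𝓝 b) := by
    intro j
    induction j with
    | zero => simpa using hlim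
    | succ j ih =>
      have h1 := ((hstep j ih).abs).const_mul C
      rw [abs_zero, mul_zero] at h1
      have h2 : Tendsto (fun k => a (l k - j) - a (l k - (j + 1))) atTop (𝓝 0) := by
        refine squeeze_zero_norm' ?_ h1
        filter_upwards [hlt.eventually_ge_atTop (j + 1)] with k hk
        have h3 := hlip (l k - (j + 1))
        rw [show l k - (j + 1) + 1 = l k - j by omega] at h3
        exact h3
      simpa using ih.sub h2
  -- Since `l (k + m + 1)` lies between `k + 1` and `k + m + 1`, every `k` equals `l (k + m + 1) -
  -- (j + 1)` for some `j ≤ m`. Only finitely many shifts `j` are therefore needed.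
  have htransfer : ∀ (u : ℕ → ℝ) (x : ℝ), (∀ j, Tendsto (fun k => u (l k - (j + 1))) atTop (𝓝 x)) →
      Tendsto u atTop (𝓝 x) := by
    intro u x hu
    refine tendsto_def.2 fun s hs => ?_
    have h1 : ∀ᶠ k in atTop, ∀ j ∈ Finset.range (m + 1), u (l k - (j + 1)) ∈ s :=
      (Finset.eventually_all _).2 fun j _ => (hu j).eventually hs
    have h2 := (tendsto_add_atTop_nat (m + 1)).eventually h1
    filter_upwards [h2] with k hk
    have h3 := hl.le_self (k + (m + 1))
    have h4 := hl.le_add (k + (m + 1))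
    have h5 := hk (l (k + (m + 1)) - (k + 1)) (Finset.mem_range.2 (by omega))
    rw [show l (k + (m + 1)) - (l (k + (m + 1)) - (k + 1) + 1) = k by omega] at h5
    exact h5
  exact ⟨htransfer a b fun j => hval (j + 1), htransfer d 0 fun j => hstep j (hval j)⟩

/-- A contraction relative to the window maximum gives an R-linear rate. -/
theorem IsWindowArgmax.exists_linear_rate (hl : IsWindowArgmax m a l) {b τ₀ : ℝ} {K : ℕ}
    (hτ₀ : τ₀ ∈ Set.Ioo (0 : ℝ) 1) (hb : ∀ k, b ≤ a (l k))
    (hmono : Antitone fun k => a (l k))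
    (hcontr : ∀ k, K ≤ k → a (k + 1) - b ≤ τ₀ * (a (l k) - b)) :
    ∃ μ τ : ℝ, 0 < μ ∧ τ ∈ Set.Ioo (0 : ℝ) 1 ∧
      ∀ k, K < k → a k - b ≤ μ * τ ^ (k - K) * (a (l K) - b) := by
  -- After `m + 1` steps the whole window lies beyond `k`, so its maximizer was produced by a
  -- contracting step from a window maximum no larger than `a (l k)`.
  have hblock : ∀ k, K ≤ k → a (l (k + (m + 1))) - b ≤ τ₀ * (a (l k) - b) := by
    intro k hk
    have h1 := hl.le_self (k + (m + 1))
    have h2 := hl.le_add (k + (m + 1))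
    have h3 := hcontr (l (k + (m + 1)) - 1) (by omega)
    rw [show l (k + (m + 1)) - 1 + 1 = l (k + (m + 1)) by omega] at h3
    have h4 : a (l (l (k + (m + 1)) - 1)) ≤ a (l k) := hmono (by omega)
    exact h3.trans (mul_le_mul_of_nonneg_left (by linarith) hτ₀.1.le)
  have hpow : ∀ q, a (l (K + q * (m + 1))) - b ≤ τ₀ ^ q * (a (l K) - b) := by
    intro q
    induction q with
    | zero => simp
    | succ q ih =>
      have h1 := hblock (K + q * (m + 1)) (by omega)
      rw [show K + q * (m + 1) + (m + 1) = K + (q + 1) * (m + 1) by ring] at h1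
      calc _ ≤ _ := h1
        _ ≤ τ₀ * (τ₀ ^ q * (a (l K) - b)) := mul_le_mul_of_nonneg_left ih hτ₀.1.le
        _ = _ := by ring
  have hm0 : (0 : ℝ) < ((m + 1 : ℕ) : ℝ)⁻¹ := by positivity
  set τ := τ₀ ^ (((m + 1 : ℕ) : ℝ)⁻¹) with hτ
  have hτpow : τ ^ (m + 1) = τ₀ := Real.rpow_inv_natCast_pow hτ₀.1.le (by omega)
  have hτ0 : 0 < τ := Real.rpow_pos_of_pos hτ₀.1 _
  have hτ1 : τ < 1 := Real.rpow_lt_one hτ₀.1.le hτ₀.2 hm0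
  -- The factor `τ₀⁻¹` pays for the last, incomplete block of fewer than `m + 1` steps.
  refine ⟨τ₀⁻¹, τ, inv_pos.2 hτ₀.1, ⟨hτ0, hτ1⟩, fun k hk => ?_⟩
  set q := (k - K) / (m + 1) with hq
  have hdiv : q * (m + 1) + (k - K) % (m + 1) = k - K := Nat.div_add_mod' _ _
  have hmod : (k - K) % (m + 1) < m + 1 := Nat.mod_lt _ (by omega)
  have h1 : a k ≤ a (l k) := hl.apply_le (by omega) le_rfl
  have h2 : a (l k) ≤ a (l (K + q * (m + 1))) := hmono (by omega)
  have h3 : τ₀ ^ q ≤ τ₀⁻¹ * τ ^ (k - K) := by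
    rw [le_inv_mul_iff₀ hτ₀.1, ← pow_succ', ← hτpow, ← pow_mul]
    refine pow_le_pow_of_le_one hτ0.le hτ1.le ?_
    rw [mul_add_one, mul_comm]
    omega
  have h4 := mul_le_mul_of_nonneg_right h3 (sub_nonneg.2 (hb K))
  have h5 := hpow q
  linarith

end Window

/-! ### Linearized model and descent along the retraction -/

theorem sqNorm_smul {n r : ℕ} (B : Mat n r →ₗ[ℝ] Mat n r) (t : ℝ) (W : Mat n r) :
    sqNorm B (t • W) = t ^ 2 * sqNorm B W := by
  unfold sqNorm
  rw [map_smul, real_inner_smul_left, real_inner_smul_right]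
  ring

/-- The change of the linearization of `f + h` at `X` in the direction `V`. -/
noncomputable def modelChange {n r : ℕ} (f h : Mat n r → ℝ) (X V : Mat n r) : ℝ :=
  inner ℝ (gradient f X) V + h (X + V) - h X

theorem modelChange_smul_le {n r : ℕ} {f h : Mat n r → ℝ} (hh : ConvexOn ℝ Set.univ h)
    (X W : Mat n r) {t : ℝ} (ht : t ∈ Set.Icc (0 : ℝ) 1) :
    modelChange f h X (t • W) ≤ t * modelChange f h X W := by
  have h1 := hh.2 (Set.mem_univ X) (Set.mem_univ (X + W)) (sub_nonneg.2 ht.2) ht.1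
    (sub_add_cancel 1 t)
  have h2 : (1 - t) • X + t • (X + W) = X + t • W := by module
  rw [h2, smul_eq_mul, smul_eq_mul] at h1
  unfold modelChange
  rw [real_inner_smul_right]
  linarith

section Descent

variable {n r : ℕ} {f h : Mat n r → ℝ} {R : Mat n r → Mat n r → Mat n r}

theorem norm_sub_le_of_mem_stiefel {X Y : Mat n r} (hX : X ∈ stiefel n r)
    (hY : Y ∈ stiefel n r) : ‖X - Y‖ ≤ 2 * √r := by
  refine (norm_sub_le X Y).trans ?_
  rw [norm_of_mem_stiefel hX, norm_of_mem_stiefel hY, two_mul]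

/-- For `‖ξ‖ ≤ 1` the second-order bound suffices; for longer `ξ` the boundedness of the manifold
does. -/
theorem IsRetraction.exists_norm_sub_le (hR : IsRetraction R) {M₂ : ℝ} (hM₂ : 0 ≤ M₂)
    (hRM₂ : ∀ Y ∈ stiefel n r, ∀ ξ ∈ tangent Y, ‖R Y ξ - Y - ξ‖ ≤ M₂ * ‖ξ‖ ^ 2) :
    ∃ M₁, 0 ≤ M₁ ∧ ∀ Y ∈ stiefel n r, ∀ ξ ∈ tangent Y, ‖R Y ξ - Y‖ ≤ M₁ * ‖ξ‖ := by
  refine ⟨1 + M₂ + 2 * √r, by positivity, fun Y hY ξ hξ => ?_⟩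
  rcases le_total ‖ξ‖ 1 with h1 | h1
  · have h2 : ‖R Y ξ - Y‖ ≤ ‖R Y ξ - Y - ξ‖ + ‖ξ‖ := by
      simpa using norm_add_le (R Y ξ - Y - ξ) ξ
    have h3 := hRM₂ Y hY ξ hξ
    have h4 : M₂ * ‖ξ‖ ^ 2 ≤ M₂ * ‖ξ‖ :=
      mul_le_mul_of_nonneg_left (by nlinarith [norm_nonneg ξ]) hM₂
    have h5 : 0 ≤ 2 * √r * ‖ξ‖ := by positivity
    linarith
  · have h2 := norm_sub_le_of_mem_stiefel (hR.mapsTo Y hY ξ hξ) hY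
    have h3 : 2 * √r ≤ 2 * √r * ‖ξ‖ := le_mul_of_one_le_right (by positivity) h1
    have h4 : 0 ≤ (1 + M₂) * ‖ξ‖ := by positivity
    linarith

theorem exists_norm_gradient_le {L : ℝ≥0} (hfL : LipschitzWith L (gradient f)) :
    ∃ G, 0 ≤ G ∧ ∀ Y ∈ stiefel n r, ‖gradient f Y‖ ≤ G := by
  refine ⟨‖gradient f 0‖ + L * √r, by positivity, fun Y hY => ?_⟩
  have h1 := hfL.norm_sub_le Y 0
  rw [sub_zero, norm_of_mem_stiefel hY] at h1
  have h2 : ‖gradient f Y‖ ≤ ‖gradient f Y - gradient f 0‖ + ‖gradient f 0‖ := by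
    simpa using norm_add_le (gradient f Y - gradient f 0) (gradient f 0)
  linarith

/-- Sufficient decrease along a retraction, up to a quadratic term. -/
theorem IsRetraction.exists_descent (hR : IsRetraction R) (hf : Differentiable ℝ f) {L : ℝ≥0}
    (hfL : LipschitzWith L (gradient f)) {Lh : ℝ≥0} (hh : ConvexOn ℝ Set.univ h)
    (hhL : LipschitzWith Lh h) {M₂ : ℝ} (hM₂ : 0 ≤ M₂)
    (hRM₂ : ∀ Y ∈ stiefel n r, ∀ ξ ∈ tangent Y, ‖R Y ξ - Y - ξ‖ ≤ M₂ * ‖ξ‖ ^ 2) :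
    ∃ C > 0, ∀ Y ∈ stiefel n r, ∀ V ∈ tangent Y, ∀ t ∈ Set.Icc (0 : ℝ) 1,
      f (R Y (t • V)) + h (R Y (t • V)) ≤
        f Y + h Y + t * modelChange f h Y V + C * t ^ 2 * ‖V‖ ^ 2 := by
  obtain ⟨M₁, hM₁, hRM₁⟩ := hR.exists_norm_sub_le hM₂ hRM₂
  obtain ⟨G, hG, hfG⟩ := exists_norm_gradient_le (f := f) hfL
  -- The terms come from replacing `R Y ξ - Y` by `ξ` in the gradient pairing, from the descent
  -- lemma, and from replacing `R Y ξ` by `Y + ξ` in `h`; the `1` makes the sum positive.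
  refine ⟨G * M₂ + L * M₁ ^ 2 + Lh * M₂ + 1, by positivity, fun Y hY V hV t ht => ?_⟩
  have htV := (tangent Y).smul_mem t hV
  obtain ⟨ξ, hξ⟩ : ∃ ξ, ξ = t • V := ⟨_, rfl⟩
  have hn : ‖ξ‖ ^ 2 = t ^ 2 * ‖V‖ ^ 2 := by
    rw [hξ, norm_smul, Real.norm_of_nonneg ht.1, mul_pow]
  have h1 := (abs_le.1 (le_of_lipschitzWith_gradient hf hfL Y (R Y ξ))).2
  have h2 := hRM₂ Y hY ξ (hξ ▸ htV)
  have h3 := hRM₁ Y hY ξ (hξ ▸ htV)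
  have h4 : inner ℝ (gradient f Y) (R Y ξ - Y) ≤
      inner ℝ (gradient f Y) ξ + G * (M₂ * ‖ξ‖ ^ 2) := by
    have h5 := (real_inner_le_norm (gradient f Y) (R Y ξ - Y - ξ)).trans
      (mul_le_mul (hfG Y hY) h2 (norm_nonneg _) hG)
    rw [inner_sub_right] at h5
    linarith
  have h6 : (L : ℝ) * ‖R Y ξ - Y‖ ^ 2 ≤ L * (M₁ * ‖ξ‖) ^ 2 := by gcongr
  have h7 := hhL.le_add_mul (R Y ξ) (Y + ξ)
  rw [dist_eq_norm, ← sub_sub] at h7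
  have h8 : (Lh : ℝ) * ‖R Y ξ - Y - ξ‖ ≤ Lh * (M₂ * ‖ξ‖ ^ 2) := by gcongr
  have h9 := modelChange_smul_le (f := f) hh Y V ht
  rw [← hξ] at h9 ⊢
  rw [modelChange] at h9
  have h10 : 0 ≤ t ^ 2 * ‖V‖ ^ 2 := by positivity
  rw [mul_pow, hn] at h6
  rw [hn] at h4 h8
  linarith

theorem IsRetraction.exists_abs_sub_le (hR : IsRetraction R) (hf : Differentiable ℝ f)
    {L : ℝ≥0} (hfL : LipschitzWith L (gradient f)) {Lh : ℝ≥0} (hhL : LipschitzWith Lh h)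
    {M₂ : ℝ} (hM₂ : 0 ≤ M₂)
    (hRM₂ : ∀ Y ∈ stiefel n r, ∀ ξ ∈ tangent Y, ‖R Y ξ - Y - ξ‖ ≤ M₂ * ‖ξ‖ ^ 2) :
    ∃ C, 0 ≤ C ∧ ∀ Y ∈ stiefel n r, ∀ ξ ∈ tangent Y,
      |f (R Y ξ) + h (R Y ξ) - (f Y + h Y)| ≤ C * ‖ξ‖ := by
  obtain ⟨M₁, hM₁, hRM₁⟩ := hR.exists_norm_sub_le hM₂ hRM₂
  obtain ⟨G, hG, hfG⟩ := exists_norm_gradient_le (f := f) hfL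
  refine ⟨(G + L * (2 * √r) + Lh) * M₁, by positivity, fun Y hY ξ hξ => ?_⟩
  have h1 := abs_le.1 (le_of_lipschitzWith_gradient hf hfL Y (R Y ξ))
  have h2 := norm_sub_le_of_mem_stiefel (hR.mapsTo Y hY ξ hξ) hY
  have h3 := abs_le.1 ((abs_real_inner_le_norm (gradient f Y) (R Y ξ - Y)).trans
    (mul_le_mul_of_nonneg_right (hfG Y hY) (norm_nonneg _)))
  have h4 := abs_le.1 ((Real.dist_eq _ _).symm.trans_le (hhL.dist_le_mul (R Y ξ) Y))
  rw [dist_eq_norm] at h4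
  have h5 : (L : ℝ) * ‖R Y ξ - Y‖ ^ 2 ≤ L * (2 * √r * ‖R Y ξ - Y‖) := by
    rw [sq]
    gcongr
  have h6 : (G + L * (2 * √r) + Lh) * ‖R Y ξ - Y‖ ≤ (G + L * (2 * √r) + Lh) * (M₁ * ‖ξ‖) :=
    mul_le_mul_of_nonneg_left (hRM₁ Y hY ξ hξ) (by positivity)
  rw [abs_le]
  constructor <;> linarith

end Descent

/-! ### Convergence of the proximal quasi-Newton method -/

section Run

variable {n r : ℕ} {f h : Mat n r → ℝ} {R : Mat n r → Mat n r → Mat n r} {m : ℕ} {σ γ : ℝ}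
  {X : ℕ → Mat n r} {B : ℕ → Mat n r →ₗ[ℝ] Mat n r} {V : ℕ → Mat n r} {N : ℕ → ℕ}

theorem IsManPQNRun.mem_stiefel (hrun : IsManPQNRun f h R m σ γ X B V N) (hR : IsRetraction R)
    (k : ℕ) : X k ∈ stiefel n r := by
  induction k with
  | zero => exact hrun.init
  | succ k ih =>
    rw [hrun.step]
    exact hR.mapsTo _ ih _ ((tangent _).smul_mem _ (hrun.direction_mem k))

/-- Comparison of the search direction with a shortened tangent vector. -/
theorem IsManPQNRun.modelChange_add_le (hrun : IsManPQNRun f h R m σ γ X B V N)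
    (hh : ConvexOn ℝ Set.univ h) (k : ℕ) {W : Mat n r} (hW : W ∈ tangent (X k)) {t : ℝ}
    (ht : t ∈ Set.Icc (0 : ℝ) 1) :
    modelChange f h (X k) (V k) + sqNorm (B k) (V k) / 2 ≤
      t * modelChange f h (X k) W + t ^ 2 * (sqNorm (B k) W / 2) := by
  have h1 := hrun.direction_min k (t • W) ((tangent _).smul_mem t hW)
  have h2 := modelChange_smul_le (f := f) hh (X k) W ht
  unfold subproblem at h1
  rw [sqNorm_smul] at h1
  unfold modelChange at h2 ⊢
  linarith

theorem IsManPQNRun.modelChange_le (hrun : IsManPQNRun f h R m σ γ X B V N)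
    (hh : ConvexOn ℝ Set.univ h) (k : ℕ) :
    modelChange f h (X k) (V k) ≤ -(sqNorm (B k) (V k) / 2) := by
  have h1 := hrun.modelChange_add_le hh k (tangent (X k)).zero_mem (Set.left_mem_Icc.2 zero_le_one)
  linarith

/-- The stepsizes of the line search are bounded away from zero. -/
theorem IsManPQNRun.exists_le_stepsize (hrun : IsManPQNRun f h R m σ γ X B V N)
    (hR : IsRetraction R) (hh : ConvexOn ℝ Set.univ h) (hσ : σ ∈ Set.Ioo (0 : ℝ) 1)
    (hγ : γ ∈ Set.Ioo (0 : ℝ) 1) {κ₁ : ℝ} (hκ₁ : 0 < κ₁)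
    (hB : ∀ k, κ₁ * ‖V k‖ ^ 2 ≤ sqNorm (B k) (V k)) {C : ℝ} (hC : 0 < C)
    (hdesc : ∀ Y ∈ stiefel n r, ∀ V ∈ tangent Y, ∀ t ∈ Set.Icc (0 : ℝ) 1,
      f (R Y (t • V)) + h (R Y (t • V)) ≤
        f Y + h Y + t * modelChange f h Y V + C * t ^ 2 * ‖V‖ ^ 2) :
    ∃ a ∈ Set.Ioc (0 : ℝ) 1, ∀ k, a ≤ γ ^ N k := by
  -- Every trial step below `b` is accepted, because the quadratic error in `hdesc` is then absorbed
  -- by the share `1 - σ` of the model decrease. The last rejected trial is hence at least `b`, and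
  -- the accepted one at least `γ * b`.
  set b := min 1 ((1 - σ) * κ₁ / (2 * C)) with hb
  have h1σ : 0 < 1 - σ := sub_pos.2 hσ.2
  have hb0 : 0 < b := lt_min one_pos (by positivity)
  have hb1 : b ≤ 1 := min_le_left _ _
  have hγb : γ * b ≤ 1 := mul_le_one₀ hγ.2.le hb0.le hb1
  refine ⟨γ * b, ⟨mul_pos hγ.1 hb0, hγb⟩, fun k => ?_⟩
  cases hN : N k with
  | zero => rwa [pow_zero]
  | succ j =>
    rw [pow_succ']
    refine mul_le_mul_of_nonneg_left ?_ hγ.1.le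
    by_contra! hlt
    have hmem : j ∉ {N : ℕ | f (R (X k) (γ ^ N • V k)) + h (R (X k) (γ ^ N • V k)) ≤
        windowMax m (fun j => f (X j) + h (X j)) k - σ * γ ^ N * sqNorm (B k) (V k) / 2} :=
      fun hj => by
        have := (hrun.lineSearch k).2 hj
        omega
    apply hmem
    have ht0 : 0 < γ ^ j := pow_pos hγ.1 j
    change f (R (X k) (γ ^ j • V k)) + h (R (X k) (γ ^ j • V k)) ≤
        windowMax m (fun j => f (X j) + h (X j)) k - σ * γ ^ j * sqNorm (B k) (V k) / 2
    set t := γ ^ j with ht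
    have h1 := hdesc (X k) (hrun.mem_stiefel hR k) (V k) (hrun.direction_mem k) t
      ⟨ht0.le, (hlt.trans_le hb1).le⟩
    have h2 : f (X k) + h (X k) ≤ windowMax m (fun j => f (X j) + h (X j)) k :=
      Finset.le_sup' (fun j => f (X j) + h (X j)) (Finset.mem_Icc.2 ⟨Nat.sub_le k m, le_rfl⟩)
    have h3 := mul_le_mul_of_nonneg_left (hrun.modelChange_le hh k) ht0.le
    have h4 : C * t ≤ (1 - σ) * κ₁ / 2 := by
      have h5 := (hlt.trans_le (min_le_right _ _)).le
      rw [le_div_iff₀ (by positivity)] at h5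
      linarith
    have h6 : C * t * ‖V k‖ ^ 2 ≤ (1 - σ) / 2 * sqNorm (B k) (V k) := by
      have h7 := mul_le_mul_of_nonneg_right h4 (sq_nonneg ‖V k‖)
      have h8 := mul_le_mul_of_nonneg_left (hB k) (by positivity : 0 ≤ (1 - σ) / 2)
      linarith
    have h9 := mul_le_mul_of_nonneg_left h6 ht0.le
    nlinarith

/-- Accumulation points of the iterates are stationary when the search directions tend to zero. -/
theorem IsManPQNRun.isStationary (hrun : IsManPQNRun f h R m σ γ X B V N)
    (hR : IsRetraction R) (hf : Continuous (gradient f)) (hh : ConvexOn ℝ Set.univ h)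
    (hhc : Continuous h) {κ₂ : ℝ}
    (hB0 : ∀ k, 0 ≤ sqNorm (B k) (V k))
    (hB : ∀ k, ∀ W ∈ tangent (X k), sqNorm (B k) W ≤ κ₂ * ‖W‖ ^ 2)
    (hV : Tendsto V atTop (𝓝 0)) {Xs : Mat n r} {φ : ℕ → ℕ} (hφ : StrictMono φ)
    (hX : Tendsto (X ∘ φ) atTop (𝓝 Xs)) : IsStationary f h Xs := by
  intro W hW
  have hquad : ∀ t ∈ Set.Icc (0 : ℝ) 1,
      0 ≤ t * modelChange f h Xs W + t ^ 2 * (κ₂ * ‖W‖ ^ 2 / 2) := by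
    intro t ht
    have hVφ : Tendsto (V ∘ φ) atTop (𝓝 0) := hV.comp hφ.tendsto_atTop
    -- A vector tangent at `Xs` need not be tangent at the iterates; its projections are, and they
    -- converge back to it.
    have hWφ : Tendsto (fun j => tangentProj (X (φ j)) W) atTop (𝓝 W) := by
      have := ((continuous_tangentProj W).tendsto Xs).comp hX
      rwa [tangentProj_of_mem_tangent hW] at this
    have hmc : Continuous fun p : Mat n r × Mat n r => modelChange f h p.1 p.2 := by
      unfold modelChange
      fun_prop
    have hleft : Tendsto (fun j => modelChange f h (X (φ j)) (V (φ j))) atTop (𝓝 0) := by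
      have h1 := (hmc.tendsto (Xs, 0)).comp (hX.prodMk_nhds hVφ)
      have h2 : modelChange f h Xs 0 = 0 := by simp [modelChange]
      rwa [h2] at h1
    have hright : Tendsto (fun j => t * modelChange f h (X (φ j)) (tangentProj (X (φ j)) W) +
        t ^ 2 * (κ₂ * ‖tangentProj (X (φ j)) W‖ ^ 2 / 2)) atTop
        (𝓝 (t * modelChange f h Xs W + t ^ 2 * (κ₂ * ‖W‖ ^ 2 / 2))) := by
      have h1 := (hmc.tendsto (Xs, W)).comp (hX.prodMk_nhds hWφ)
      exact (h1.const_mul t).add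
        ((((hWφ.norm.pow 2).const_mul κ₂).div_const 2).const_mul (t ^ 2))
    refine le_of_tendsto_of_tendsto' hleft hright fun j => ?_
    have hmem := tangentProj_mem_tangent (hrun.mem_stiefel hR (φ j)) W
    have h1 := hrun.modelChange_add_le hh (φ j) hmem ht
    have h2 := mul_le_mul_of_nonneg_left (hB (φ j) _ hmem) (sq_nonneg t)
    have h3 := hB0 (φ j)
    linarith
  have hlim : Tendsto (fun t : ℝ => modelChange f h Xs W + t * (κ₂ * ‖W‖ ^ 2 / 2)) (𝓝[>] 0)
      (𝓝 (modelChange f h Xs W)) := by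
    have h1 : Continuous fun t : ℝ => modelChange f h Xs W + t * (κ₂ * ‖W‖ ^ 2 / 2) := by fun_prop
    have h2 := h1.tendsto 0
    rw [zero_mul, add_zero] at h2
    exact h2.mono_left nhdsWithin_le_nhds
  -- Dividing `hquad` by `t` and letting `t` tend to `0` removes the quadratic term.
  have hge : 0 ≤ modelChange f h Xs W := by
    refine ge_of_tendsto hlim ?_
    filter_upwards [Ioc_mem_nhdsGT one_pos] with t ht
    have h1 := hquad t ⟨ht.1.le, ht.2⟩
    refine nonneg_of_mul_nonneg_right (b := _) (a := t) ?_ ht.1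
    linarith
  unfold modelChange at hge
  linarith

/-- The iterates stay near an accumulation point with quadratic growth. -/
theorem eventually_mem_ball_of_growth {E : Type*} [NormedAddCommGroup E] {x : ℕ → E} {a : ℕ → ℝ}
    {y : E} {b c ε : ℝ} (hc : 0 < c) (hε : 0 < ε) (hacc : MapClusterPt y atTop x)
    (ha : Tendsto a atTop (𝓝 b)) (hstep : Tendsto (fun k => x (k + 1) - x k) atTop (𝓝 0))
    (hgrowth : ∀ k, x k ∈ Metric.ball y ε → b + c * ‖x k - y‖ ^ 2 ≤ a k) :
    ∃ K, ∀ k, K ≤ k → x k ∈ Metric.ball y ε := by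
  have h1 : ∀ᶠ k in atTop, a k < b + c * (ε / 2) ^ 2 :=
    ha.eventually (gt_mem_nhds (lt_add_of_pos_right b (by positivity)))
  have h2 : ∀ᶠ k in atTop, ‖x (k + 1) - x k‖ < ε / 2 := by
    have h3 := hstep.norm
    rw [norm_zero] at h3
    exact h3.eventually (gt_mem_nhds (half_pos hε))
  obtain ⟨K₀, hK₀⟩ := eventually_atTop.1 (h1.and h2)
  obtain ⟨K, hKK₀, hK⟩ := frequently_atTop.1
    (hacc.frequently (Metric.ball_mem_nhds y hε)) K₀
  refine ⟨K, fun k hk => ?_⟩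
  induction k, hk using Nat.le_induction with
  | base => exact hK
  | succ k hk ih =>
    obtain ⟨h3, h4⟩ := hK₀ k (hKK₀.trans hk)
    have h5 := hgrowth k ih
    -- While `x k` is in the ball, growth and the small value force it into the half ball; a step
    -- shorter than `ε / 2` cannot leave the ball from there.
    have h6 : ‖x k - y‖ < ε / 2 := by
      refine lt_of_pow_lt_pow_left₀ 2 (by positivity) ?_
      refine lt_of_mul_lt_mul_left ?_ hc.le
      linarith
    rw [mem_ball_iff_norm]
    have h7 := norm_add_le (x (k + 1) - x k) (x k - y)
    rw [sub_add_sub_cancel] at h7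
    linarith

/-- One step contracts the distance to the optimal value, where `f + h` has quadratic growth
relative to its linearization. -/
theorem IsManPQNRun.contraction (hrun : IsManPQNRun f h R m σ γ X B V N)
    (hh : ConvexOn ℝ Set.univ h) {k : ℕ} {W : Mat n r} (hW : W ∈ tangent (X k))
    {κ₁ κ₂ : ℝ} (hκ₁ : 0 < κ₁) (hB₁ : κ₁ * ‖V k‖ ^ 2 ≤ sqNorm (B k) (V k))
    (hB₂ : sqNorm (B k) W ≤ κ₂ * ‖W‖ ^ 2) (hσ : 0 < σ)
    {C : ℝ} (hC : 0 < C) {a : ℝ} (ha : 0 < a) (hk : a ≤ γ ^ N k) (hk1 : γ ^ N k ≤ 1)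
    (hdesc : f (X (k + 1)) + h (X (k + 1)) ≤ f (X k) + h (X k) +
      γ ^ N k * modelChange f h (X k) (V k) + C * (γ ^ N k) ^ 2 * ‖V k‖ ^ 2)
    {t c b M : ℝ} (ht : t ∈ Set.Ioc (0 : ℝ) 1) (htc : t * κ₂ / 2 ≤ c)
    (hgrowth : f (X k) + h (X k) + modelChange f h (X k) W + c * ‖W‖ ^ 2 ≤ b)
    (hkM : f (X k) + h (X k) ≤ M) (hbM : b ≤ M)
    (hline : f (X (k + 1)) + h (X (k + 1)) ≤ M - σ * γ ^ N k * sqNorm (B k) (V k) / 2) :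
    f (X (k + 1)) + h (X (k + 1)) - b ≤
      (1 - (σ * κ₁ / 2) / (σ * κ₁ / 2 + C) * (a * t)) * (M - b) := by
  set α := γ ^ N k with hα
  have hα0 : 0 < α := ha.trans_le hk
  have hq0 : 0 ≤ sqNorm (B k) (V k) := le_trans (by positivity) hB₁
  -- The competitor is `t • W`. Its quadratic cost `t² κ₂ ‖W‖² / 2` is at most `t c ‖W‖²` by `htc`,
  -- and the growth term pays for it.
  have hΔ : modelChange f h (X k) (V k) ≤ t * (b - (f (X k) + h (X k))) := by
    have h1 := hrun.modelChange_add_le hh k hW ⟨ht.1.le, ht.2⟩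
    have h2 := mul_le_mul_of_nonneg_left hgrowth ht.1.le
    have h3 := mul_le_mul_of_nonneg_left hB₂ (sq_nonneg t)
    have h4 := mul_le_mul_of_nonneg_left
      (mul_le_mul_of_nonneg_right htc (sq_nonneg ‖W‖)) ht.1.le
    linarith
  set c₁ := σ * κ₁ / 2 with hc₁
  have hc₁0 : 0 < c₁ := by positivity
  have hαt : α * t ≤ 1 := mul_le_one₀ hk1 ht.1.le ht.2
  have hv : 0 ≤ α * ‖V k‖ ^ 2 := by positivity
  have hfirst : f (X (k + 1)) + h (X (k + 1)) - b ≤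
      (1 - α * t) * (M - b) + C * (α * ‖V k‖ ^ 2) := by
    have h1 := mul_le_mul_of_nonneg_left hΔ hα0.le
    have h2 := mul_le_mul_of_nonneg_left hkM (sub_nonneg.2 hαt)
    have h3 : C * α ^ 2 * ‖V k‖ ^ 2 ≤ C * (α * ‖V k‖ ^ 2) := by
      have := mul_le_mul_of_nonneg_left (mul_le_of_le_one_left hv hk1) hC.le
      linarith
    linarith
  have hsecond : f (X (k + 1)) + h (X (k + 1)) - b ≤ (M - b) - c₁ * (α * ‖V k‖ ^ 2) := by
    have h1 := mul_le_mul_of_nonneg_left hB₁ (by positivity : 0 ≤ σ * α / 2)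
    rw [hc₁]
    linarith
  have hcC : 0 < c₁ + C := by positivity
  -- The convex combination of `hfirst` and `hsecond` with weights `c₁ / (c₁ + C)` and `C / (c₁ +
  -- C)` cancels the terms in `α * ‖V k‖ ^ 2`.
  have hcomb : f (X (k + 1)) + h (X (k + 1)) - b ≤
      (1 - c₁ / (c₁ + C) * (α * t)) * (M - b) := by
    have h1 : (1 - c₁ / (c₁ + C) * (α * t)) * (M - b) =
        ((c₁ + C - c₁ * (α * t)) * (M - b)) / (c₁ + C) := by
      field_simp
    rw [h1, le_div_iff₀ hcC]
    have h2 := mul_le_mul_of_nonneg_left hfirst hc₁0.le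
    have h3 := mul_le_mul_of_nonneg_left hsecond hC.le
    linarith
  refine hcomb.trans (mul_le_mul_of_nonneg_right ?_ (sub_nonneg.2 hbM))
  have h1 : a * t ≤ α * t := mul_le_mul_of_nonneg_right hk ht.1.le
  have h2 := mul_le_mul_of_nonneg_left h1 (div_pos hc₁0 hcC).le
  linarith

/-- R-linear convergence of the function values at a nondegenerate accumulation point. -/
theorem IsManPQNRun.exists_linear_rate (hrun : IsManPQNRun f h R m σ γ X B V N)
    (hR : IsRetraction R) (hf : ContDiff ℝ 2 f) {L : ℝ≥0} (hfL : LipschitzWith L (gradient f))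
    {Lh : ℝ≥0} (hh : ConvexOn ℝ Set.univ h) (hhL : LipschitzWith Lh h)
    (hσ : σ ∈ Set.Ioo (0 : ℝ) 1) (hγ : γ ∈ Set.Ioo (0 : ℝ) 1) {κ₁ κ₂ : ℝ} (hκ₁ : 0 < κ₁)
    (hB : ∀ k, ∀ W ∈ tangent (X k),
      κ₁ * ‖W‖ ^ 2 ≤ sqNorm (B k) W ∧ sqNorm (B k) W ≤ κ₂ * ‖W‖ ^ 2)
    {M₂ : ℝ} (hM₂ : 0 ≤ M₂)
    (hRM₂ : ∀ Y ∈ stiefel n r, ∀ ξ ∈ tangent Y, ‖R Y ξ - Y - ξ‖ ≤ M₂ * ‖ξ‖ ^ 2)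
    {Xs : Mat n r} (hacc : MapClusterPt Xs atTop X) {η : ℝ} (hη : 4 * (Lh : ℝ) * M₂ < η)
    (hHess : MinEigenvalueGE (hessian (fun ξ : tangent Xs => f (R Xs ξ)) 0) η)
    {l : ℕ → ℕ} (hl : IsWindowArgmax m (fun j => f (X j) + h (X j)) l) :
    ∃ (K : ℕ) (μ τ : ℝ), 0 < μ ∧ τ ∈ Set.Ioo (0 : ℝ) 1 ∧
      ∀ k : ℕ, K < k → (f (X k) + h (X k)) - (f Xs + h Xs) ≤
        μ * τ ^ (k - K) * ((f (X (l K)) + h (X (l K))) - (f Xs + h Xs)) := by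
  have hfd : Differentiable ℝ f := hf.differentiable two_ne_zero
  have hX := hrun.mem_stiefel hR
  have hV := hrun.direction_mem
  have hB₁ : ∀ k, κ₁ * ‖V k‖ ^ 2 ≤ sqNorm (B k) (V k) := fun k => (hB k _ (hV k)).1
  have hB₂ : ∀ k, ∀ W ∈ tangent (X k), sqNorm (B k) W ≤ κ₂ * ‖W‖ ^ 2 := fun k W hW => (hB k W hW).2
  have hB₀ : ∀ k, 0 ≤ sqNorm (B k) (V k) := fun k => le_trans (by positivity) (hB₁ k)
  obtain ⟨φ, hφ, hXφ⟩ := hacc.tendsto_subseq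
  have hXs : Xs ∈ stiefel n r :=
    (isClosed_stiefel n r).mem_of_tendsto hXφ (Eventually.of_forall fun j => hX (φ j))
  obtain ⟨C, hC, hdesc⟩ := hR.exists_descent hfd hfL hh hhL hM₂ hRM₂
  obtain ⟨C', hC', habs⟩ := hR.exists_abs_sub_le hfd hfL hhL hM₂ hRM₂
  obtain ⟨M₁, hM₁, hRM₁⟩ := hR.exists_norm_sub_le hM₂ hRM₂
  obtain ⟨α, hα, hαN⟩ := hrun.exists_le_stepsize hR hh hσ hγ hκ₁ hB₁ hC hdesc
  have hN0 : ∀ k, 0 < γ ^ N k := fun k => pow_pos hγ.1 _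
  have hN1 : ∀ k, γ ^ N k ≤ 1 := fun k => pow_le_one₀ hγ.1.le hγ.2.le
  obtain ⟨F, hF⟩ : ∃ F : ℕ → ℝ, F = fun j => f (X j) + h (X j) := ⟨_, rfl⟩
  have hFk : ∀ k, F k = f (X k) + h (X k) := fun k => by rw [hF]
  rw [← hF] at hl
  have hline : ∀ k, F (k + 1) ≤ F (l k) - σ * γ ^ N k * sqNorm (B k) (V k) / 2 := by
    intro k
    have h1 := (hrun.lineSearch k).1
    rw [Set.mem_ofPred_eq, ← hF, hl.windowMax_eq, ← hrun.step, ← hFk] at h1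
    exact h1
  have hdec : ∀ k, F (k + 1) ≤ F (l k) - σ * α * κ₁ / 2 * ‖V k‖ ^ 2 := by
    intro k
    have h1 : σ * α * (κ₁ * ‖V k‖ ^ 2) ≤ σ * γ ^ N k * sqNorm (B k) (V k) :=
      mul_le_mul (mul_le_mul_of_nonneg_left (hαN k) hσ.1.le) (hB₁ k) (by positivity)
        (mul_nonneg hσ.1.le (hN0 k).le)
    have h2 := hline k
    linarith
  have hc : 0 < σ * α * κ₁ / 2 := by
    have := hσ.1
    have := hα.1
    positivity
  have hanti : Antitone fun k => F (l k) := hl.antitone fun k =>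
    (hdec k).trans (sub_le_self _ (by positivity))
  have hstepnorm : ∀ k, ‖γ ^ N k • V k‖ ≤ ‖V k‖ := fun k => by
    rw [norm_smul, Real.norm_of_nonneg (hN0 k).le]
    exact mul_le_of_le_one_left (norm_nonneg _) (hN1 k)
  have hlip : ∀ k, |F (k + 1) - F k| ≤ C' * |‖V k‖| := by
    intro k
    rw [hFk, hFk, hrun.step, abs_norm]
    exact (habs _ (hX k) _ ((tangent _).smul_mem _ (hV k))).trans
      (mul_le_mul_of_nonneg_left (hstepnorm k) hC')
  obtain ⟨b, hb⟩ : ∃ b, b = f Xs + h Xs := ⟨_, rfl⟩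
  have hFφ : Tendsto (F ∘ φ) atTop (𝓝 b) := by
    have h1 : Continuous fun Y => f Y + h Y := hf.continuous.add hhL.continuous
    have h2 := (h1.tendsto Xs).comp hXφ
    rw [← hb] at h2
    rw [hF]
    exact h2
  have hbF : ∀ k, b ≤ F (l k) := by
    intro k
    refine le_of_tendsto hFφ ?_
    filter_upwards [eventually_ge_atTop k] with j hj
    have h1 : F (φ j) ≤ F (l (φ j)) := hl.apply_le (Nat.le_add_right _ _) le_rfl
    exact h1.trans (hanti (hj.trans (hφ.id_le j)))
  -- The window maxima decrease and are bounded below, so all values converge; the subsequence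
  -- through `Xs` identifies the limit as `b`.
  obtain ⟨hFlim, hVlim⟩ : Tendsto F atTop (𝓝 b) ∧ Tendsto V atTop (𝓝 0) := by
    have h1 : Tendsto (fun k => F (l k)) atTop (𝓝 (⨅ k, F (l k))) :=
      tendsto_atTop_ciInf hanti ⟨b, by rintro _ ⟨k, rfl⟩; exact hbF k⟩
    obtain ⟨h2, h3⟩ := hl.tendsto_of_decrease hc hdec hlip h1
    rw [tendsto_nhds_unique hFφ (h2.comp hφ.tendsto_atTop)]
    exact ⟨h2, tendsto_zero_iff_norm_tendsto_zero.2 h3⟩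
  have hstat : IsStationary f h Xs := hrun.isStationary hR (contDiff_one_gradient hf).continuous hh
    hhL.continuous hB₀ hB₂ hVlim hφ hXφ
  obtain ⟨c, hc0, hgrowth⟩ := exists_eventually_growth hR hf hhL hRM₂ hXs hstat hη hHess
  obtain ⟨ε, hε, hball⟩ := Metric.eventually_nhds_iff_ball.1 hgrowth
  have hXstep : Tendsto (fun k => X (k + 1) - X k) atTop (𝓝 0) := by
    have h1 := hVlim.norm.const_mul M₁
    rw [norm_zero, mul_zero] at h1
    refine squeeze_zero_norm (fun k => ?_) h1
    rw [hrun.step]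
    exact (hRM₁ _ (hX k) _ ((tangent _).smul_mem _ (hV k))).trans
      (mul_le_mul_of_nonneg_left (hstepnorm k) hM₁)
  -- Growth based at `Xs`: stationarity bounds the linearization below by `b`.
  have hgrow₀ : ∀ k, X k ∈ Metric.ball Xs ε → b + c * ‖X k - Xs‖ ^ 2 ≤ F k := by
    intro k hk
    have h1 := hball (Xs, X k) (by
      rw [← ball_prod_same]
      exact ⟨Metric.mem_ball_self hε, hk⟩) hXs (hX k)
    have h2 := hstat _ (sub_add_normalPart_mem_tangent hXs (hX k))
    rw [hFk, hb]
    dsimp only at h1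
    linarith
  obtain ⟨K, hK⟩ := eventually_mem_ball_of_growth hc0 hε hacc hFlim hXstep hgrow₀
  obtain ⟨t, ht, htc⟩ : ∃ t ∈ Set.Ioc (0 : ℝ) 1, t * κ₂ / 2 ≤ c := by
    have hden : 0 < |κ₂| + 1 := by positivity
    -- No sign of `κ₂` is assumed, hence the denominator `|κ₂| + 1`.
    refine ⟨min 1 (2 * c / (|κ₂| + 1)), ⟨lt_min one_pos (by positivity), min_le_left _ _⟩, ?_⟩
    have h0 : 0 < min 1 (2 * c / (|κ₂| + 1)) := lt_min one_pos (by positivity)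
    have h1 : min 1 (2 * c / (|κ₂| + 1)) * (|κ₂| + 1) ≤ 2 * c :=
      (le_div_iff₀ hden).1 (min_le_right _ _)
    have h2 : min 1 (2 * c / (|κ₂| + 1)) * κ₂ ≤ min 1 (2 * c / (|κ₂| + 1)) * (|κ₂| + 1) :=
      mul_le_mul_of_nonneg_left ((le_abs_self κ₂).trans (by linarith)) h0.le
    linarith
  have hc₁ : 0 < σ * κ₁ / 2 := by
    have := hσ.1
    positivity
  have hθ0 : 0 < σ * κ₁ / 2 / (σ * κ₁ / 2 + C) := by positivity
  have hθ1 : σ * κ₁ / 2 / (σ * κ₁ / 2 + C) < 1 := (div_lt_one (by positivity)).2 (by linarith)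
  have hαt0 : 0 < α * t := mul_pos hα.1 ht.1
  have hαt1 : α * t ≤ 1 := mul_le_one₀ hα.2 ht.1.le ht.2
  have hτ : 1 - σ * κ₁ / 2 / (σ * κ₁ / 2 + C) * (α * t) ∈ Set.Ioo (0 : ℝ) 1 :=
    ⟨sub_pos.2 (mul_lt_one_of_nonneg_of_lt_one_left hθ0.le hθ1 hαt1),
      sub_lt_self _ (mul_pos hθ0 hαt0)⟩
  -- Growth is now based at `X k` with end point `Xs`. The tangent vector `W` is no longer than the
  -- chord, so `c * ‖W‖ ^ 2` may replace the growth term of the chord.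
  obtain ⟨μ, τ, hμ, hτ', hrate⟩ := hl.exists_linear_rate (K := K) hτ hbF hanti fun k hk => by
    have hW := sub_add_normalPart_mem_tangent (hX k) hXs
    have h1 := hball (X k, Xs) (by
      rw [← ball_prod_same]
      exact ⟨hK k hk, Metric.mem_ball_self hε⟩) (hX k) hXs
    dsimp only at h1
    have h2 := norm_le_norm_sub_normalPart (D := Xs - X k) hW
    rw [add_sub_cancel_right] at h2
    have h3 := mul_le_mul_of_nonneg_left (pow_le_pow_left₀ (norm_nonneg _) h2 2) hc0.le
    have h4 := hdesc _ (hX k) _ (hV k) _ ⟨(hN0 k).le, hN1 k⟩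
    rw [← hrun.step] at h4
    have h5 := hline k
    have h6 : F k ≤ F (l k) := hl.apply_le (Nat.le_add_right _ _) le_rfl
    rw [hFk k] at h6
    rw [hFk (k + 1)] at h5 ⊢
    refine hrun.contraction hh hW hκ₁ (hB₁ k) (hB₂ k _ hW) hσ.1 hC hα.1 (hαN k) (hN1 k) h4 ht htc
      ?_ h6 (hbF k) h5
    rw [modelChange, hb]
    linarith
  refine ⟨K, μ, τ, hμ, hτ', fun k hk => ?_⟩
  have h1 := hrate k hk
  rw [hFk, hFk, hb] at h1
  exact h1

end Run

end ManPQN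

theorem theorem4p3 {n r : ℕ}
    (f h : ManPQN.Mat n r → ℝ) (R : ManPQN.Mat n r → ManPQN.Mat n r → ManPQN.Mat n r)
    (hR : ManPQN.IsRetraction R)
    -- `f` is twice continuously differentiable with Lipschitz gradient
    (L : ℝ≥0) (hf : ContDiff ℝ 2 f) (hfL : LipschitzWith L (gradient f))
    -- `h` is convex and Lipschitz
    (Lh : ℝ≥0) (hh : ConvexOn ℝ Set.univ h) (hhL : LipschitzWith Lh h)
    -- the algorithm and its output
    (m : ℕ) (hm : 0 < m) (σ γ : ℝ) (hσ : σ ∈ Set.Ioo (0 : ℝ) 1) (hγ : γ ∈ Set.Ioo (0 : ℝ) 1)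
    (X : ℕ → ManPQN.Mat n r) (B : ℕ → ManPQN.Mat n r →ₗ[ℝ] ManPQN.Mat n r)
    (V : ℕ → ManPQN.Mat n r) (N : ℕ → ℕ)
    (hrun : ManPQN.IsManPQNRun f h R m σ γ X B V N)
    -- the uniform bounds on the operators
    (κ₁ κ₂ : ℝ) (hκ₁ : 0 < κ₁)
    (hB : ∀ k, ∀ W ∈ ManPQN.tangent (X k),
      κ₁ * ‖W‖ ^ 2 ≤ ManPQN.sqNorm (B k) W ∧ ManPQN.sqNorm (B k) W ≤ κ₂ * ‖W‖ ^ 2)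
    -- the second-order constant of the retraction
    (M₂ : ℝ) (hM₂ : 0 < M₂)
    (hRM₂ : ∀ Y ∈ ManPQN.stiefel n r, ∀ ξ ∈ ManPQN.tangent Y,
      ‖R Y ξ - Y - ξ‖ ≤ M₂ * ‖ξ‖ ^ 2)
    -- the accumulation point with the nondegeneracy condition
    (Xstar : ManPQN.Mat n r) (hacc : MapClusterPt Xstar Filter.atTop X)
    (η : ℝ) (hη : 5 * (Lh : ℝ) * M₂ < η)
    (hHess : ManPQN.MinEigenvalueGE
      (ManPQN.hessian (fun ξ : ManPQN.tangent Xstar => f (R Xstar ξ)) 0) η)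
    -- a choice of the maximizing indices `l(k)`
    (l : ℕ → ℕ) (hl : ManPQN.IsWindowArgmax m (fun j => f (X j) + h (X j)) l) :
    ∃ (K : ℕ) (μ τ : ℝ), 0 < μ ∧ τ ∈ Set.Ioo (0 : ℝ) 1 ∧
      ∀ k : ℕ, K < k →
        (f (X k) + h (X k)) - (f Xstar + h Xstar) ≤
          μ * τ ^ (k - K) * ((f (X (l K)) + h (X (l K))) - (f Xstar + h Xstar)) := by
  exact hrun.exists_linear_rate hR hf hfL hh hhL hσ hγ hκ₁ hB hM₂.le hRM₂ hacc
    (lt_of_le_of_lt (by gcongr; norm_num) hη) hHess hl
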